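/- Let $n$ be a natural number and let $\Gamma$ be a finite connected graph (a finite connected CW complex with cells of dimension $0$ and $1$ only; loops and multiple edges are not excluded a priori) that is not a subdivided circle, i.e. at least one vertex of $\Gamma$ has degree different from $2$. The degree of a vertex is the number of ends of edges at it, and a vertex is called essential if its degree is at least $3$. Assume that $\Gamma$ is sufficiently subdivided for $n$: it has at least $n$ vertices, each path between distinct vertices of degree not equal to $2$ passes through at least $n-1$ edges, and each homotopically nontrivial path from a vertex to itself passes through at least $n+1$ edges. Let $\Delta=\{(x_1,\dots,x_n)\in\Gamma^n : x_i=x_j \text{ for some } i\ne j\}$, let $\Delta'$ be the union of those open cells of the product complex $\Gamma^n$ whose closures intersect $\Delta$, let $D^n\Gamma=\Gamma^n\setminus\Delta'$, and let $UD^n\Gamma$ be the quotient of $D^n\Gamma$ by the action of the symmetric group $S_n$ permuting the coordinates. Let $\chi(\Gamma)$ be the Euler characteristic of $\Gamma$. Then $UD^n\Gamma$ strong deformation retracts onto a subspace that is a CW complex of dimension at most $$k:=\min\left\{\left\lfloor\frac{n+1-\chi(\Gamma)}{2}\right\rfloor,\ \#\{v \text{ a vertex of } \Gamma : v \text{ is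 essential}\}\right\}.$$ -/

import Mathlib

open Set Topology

universe u

namespace GraphBraid

noncomputable section

/-! ### Graphs

A finite graph is a finite CW complex `Γ` all of whose cells have dimension `0` (vertices) or
`1` (edges). Multiple edges and loops are not excluded. -/

section Graph

variable (Γ : Type u) [TopologicalSpace Γ] [CWComplex (univ : Set Γ)]

/-- The vertices of `Γ`. -/
abbrev Vertex : Type u := RelCWComplex.cell (univ : Set Γ) 0

/-- The edges of `Γ`. -/
abbrev Edge : Type u := RelCWComplex.cell (univ : Set Γ) 1

variable {Γ}

/-- The point of `Γ` given by the vertex `v`. -/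
def vertexPoint (v : Vertex Γ) : Γ := RelCWComplex.map (C := (univ : Set Γ)) 0 v ![]

/-- The two ends of the edge `e`: the images of `1` (for `true`) and of `-1` (for `false`) under
the characteristic map `[-1, 1] → Γ` of `e`. -/
def edgeEnd (e : Edge Γ) (b : Bool) : Γ :=
  RelCWComplex.map (C := (univ : Set Γ)) 1 e (fun _ => if b then 1 else -1)

/-- The degree of a vertex: the number of ends of edges at `v` (so a loop counts twice). -/
def degree (v : Vertex Γ) : ℕ :=
  Nat.card {p : Edge Γ × Bool // edgeEnd p.1 p.2 = vertexPoint v}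

/-- A vertex is essential if its degree is at least `3`. -/
def IsEssential (v : Vertex Γ) : Prop := 3 ≤ degree v

variable (Γ) in
/-- The Euler characteristic of a finite graph. -/
def eulerChar : ℤ := (Nat.card (Vertex Γ) : ℤ) - (Nat.card (Edge Γ) : ℤ)

/-- `IsEdgePath u w l`: the list `l` of oriented edges is an edge path from `u` to `w`, where
`(e, b)` stands for the edge `e` traversed from the end `edgeEnd e (!b)` to `edgeEnd e b`. -/
inductive IsEdgePath : Vertex Γ → Vertex Γ → List (Edge Γ × Bool) → Prop
  | nil (v : Vertex Γ) : IsEdgePath v v []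
  | cons {u v w : Vertex Γ} {e : Edge Γ} {b : Bool} {l : List (Edge Γ × Bool)}
      (hu : edgeEnd e (!b) = vertexPoint u) (hv : edgeEnd e b = vertexPoint v)
      (h : IsEdgePath v w l) : IsEdgePath u w ((e, b) :: l)

/-- A closed edge path is homotopically trivial if it can be transformed into the constant path
by deleting and inserting backtracks `(e, b), (e, !b)`, that is, if it represents the identity of
the free group on the set of edges. -/
def IsHomotopicallyTrivial (l : List (Edge Γ × Bool)) : Prop :=
  FreeGroup.mk l = (1 : FreeGroup (Edge Γ))

variable (Γ) in
/-- `Γ` is sufficiently subdivided for `n`: it has at least `n` vertices, each path between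
distinct vertices of degree not equal to `2` passes through at least `n - 1` edges, and each
homotopically nontrivial path from a vertex to itself passes through at least `n + 1` edges. -/
structure SufficientlySubdivided (n : ℕ) : Prop where
  le_card_vertex : n ≤ Nat.card (Vertex Γ)
  le_length_path : ∀ (u v : Vertex Γ) (l : List (Edge Γ × Bool)), u ≠ v → degree u ≠ 2 →
    degree v ≠ 2 → IsEdgePath u v l → n ≤ l.length + 1
  le_length_loop : ∀ (v : Vertex Γ) (l : List (Edge Γ × Bool)), IsEdgePath v v l →
    ¬ IsHomotopicallyTrivial l → n + 1 ≤ l.length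

end Graph

/-! ### Discretized configuration spaces -/

section Configuration

variable (n : ℕ) (Γ : Type u) [TopologicalSpace Γ] [CWComplex (univ : Set Γ)]

/-- The diagonal `Δ` of `Γⁿ`: at least two coordinates agree. -/
def diagonal : Set (Fin n → Γ) := {x | ∃ i j, i ≠ j ∧ x i = x j}

/-- An open cell of `Γⁿ` is a product of `n` open cells of `Γ`. -/
def openProductCell (c : Fin n → Σ d : ℕ, RelCWComplex.cell (univ : Set Γ) d) :
    Set (Fin n → Γ) :=
  {x | ∀ i, x i ∈ RelCWComplex.openCell (C := (univ : Set Γ)) (c i).1 (c i).2}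

/-- `Δ'`: the union of those open cells of `Γⁿ` whose closures intersect the diagonal. -/
def fatDiagonal : Set (Fin n → Γ) :=
  ⋃ (c : Fin n → Σ d : ℕ, RelCWComplex.cell (univ : Set Γ) d)
    (_ : (closure (openProductCell n Γ c) ∩ diagonal n Γ).Nonempty), openProductCell n Γ c

/-- The labelled discretized configuration space `DⁿΓ = Γⁿ - Δ'`, a subspace of `Γⁿ`. -/
abbrev DConf : Type u := {x : Fin n → Γ // x ∉ fatDiagonal n Γ}

/-- Two labelled configurations are equivalent if they differ by a permutation of the
coordinates. -/
def permSetoid : Setoid (DConf n Γ) where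
  r x y := ∃ σ : Equiv.Perm (Fin n), ∀ i, y.1 i = x.1 (σ i)
  iseqv :=
    { refl := fun _ => ⟨1, fun _ => rfl⟩
      symm := fun {_ _} ⟨σ, h⟩ => ⟨σ⁻¹, fun i => by simp [h]⟩
      trans := fun {_ _ _} ⟨σ, h⟩ ⟨τ, k⟩ => ⟨σ * τ, fun i => by simp [h, k]⟩ }

/-- The unlabelled discretized configuration space `UDⁿΓ`: the quotient of `DⁿΓ` by the action of
the symmetric group, with the quotient topology. -/
abbrev UDConf : Type u := Quotient (permSetoid n Γ)

end Configuration

/-- `Y` is a strong deformation retract of `X`: there is a homotopy from the identity of `X` to a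
map with image in `Y` that fixes every point of `Y` at all times. -/
def IsStrongDeformationRetract {X : Type u} [TopologicalSpace X] (Y : Set X) : Prop :=
  ∃ r : C(X, X), (∀ x, r x ∈ Y) ∧ (ContinuousMap.id X).HomotopicRel r Y

end

end GraphBraid

/-! The cells of `UDConf` are cubes, one for every set of `n` vertices and edges of `Γ` with
pairwise disjoint closures (`IsConf`); the dimension is the number of edges. The proof is a discrete
Morse argument carried out by explicit collapses of cubes.

Fix a spanning tree rooted at a vertex of degree different from `2`, and label the vertices
increasingly away from the root. In a cell, a vertex may expand to its tree edge if its parent is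
free; a tree edge may shrink to its end away from the root if no vertex of the cell with the same
parent has a smaller label. The move of least label is undone by the move of least label in the
resulting cell (`RedAt.colAt_up`, `ColAt.redAt_down`), so all cells with a move are matched in
pairs. A lexicographic height drops strictly from a redundant cell to the next one on a gradient
path (`height_lt`). Hence a redundant cell of greatest height among those still to be removed is a
free facet of its partner, and the pairs can be removed one by one (`collapse_induction`).

What remains has dimension at most `k`, because a cell without an order-respecting edge does, for
two reasons. Each of its tree edges is held back by a vertex of its own, and at most `1 - χ(Γ)`
edges lie outside the tree; counting gives the bound by the Euler characteristic
(`two_mul_card_toRight_le`). Moreover each of its edges touches an essential vertex, and disjoint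
closures make these vertices distinct (`card_toRight_le_card_essential`). For a tree edge the tree
branches at the parent; for an edge outside the tree one end has a child, because the tree is chosen
with maximal total depth (`exists_spanTree_child`).

Geometrically, subdivision excludes loops, so closed cells are embedded cubes, and central
projection of a cube onto all facets but one realizes an elementary collapse
(`isStrongDeformationRetract_diff`). The surviving subcomplex has the evident cubical CW structure
(`exists_cwComplex_realization`). -/

namespace GraphBraid

/-! ### Rooted spanning trees of finite multigraphs -/

section Trees

variable {V E : Type*} {bd : E → Bool → V} {r : V}

/-- A spanning tree rooted at `r` of the multigraph with end map `bd`: the depth of each vertex,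
its parent and the edge leading to its parent (the last two are meaningless at `r`). -/
structure SpanTree (bd : E → Bool → V) (r : V) where
  depth : V → ℕ
  parent : V → V
  edge : V → E
  depth_root : depth r = 0
  depth_eq : ∀ v, v ≠ r → depth v = depth (parent v) + 1
  ends : ∀ v, v ≠ r → ∃ b, bd (edge v) b = v ∧ bd (edge v) (!b) = parent v

/-- `v` can be reached from `r` by a path with `k` edges. -/
def ReachIn (bd : E → Bool → V) (r : V) : ℕ → V → Prop
  | 0, v => v = r
  | k + 1, v => ∃ e b, ReachIn bd r k (bd e b) ∧ bd e (!b) = v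

/-- Breadth-first search: the depth is the distance from `r`, and the parent is the penultimate
vertex of a shortest path. `Nonempty E` only supplies the meaningless edge at the root. -/
theorem exists_spanTree [Nonempty E]
    (hconn : ∀ S : Set V, r ∈ S → (∀ e b, bd e b ∈ S → bd e (!b) ∈ S) → S = univ) :
    Nonempty (SpanTree bd r) := by
  classical
  have hr : ∀ v, ∃ k, ReachIn bd r k v := by
    have := hconn {v | ∃ k, ReachIn bd r k v} ⟨0, rfl⟩
      (fun e b ⟨k, hk⟩ => ⟨k + 1, e, b, hk, rfl⟩)
    exact fun v => this.ge (mem_univ v)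
  have hd : ∀ v, ∃ e b, v ≠ r →
      (Nat.find (hr v) = Nat.find (hr (bd e (!b))) + 1 ∧ bd e b = v) := by
    intro v
    by_cases hv : v = r
    · exact ⟨Classical.arbitrary E, true, fun h => absurd hv h⟩
    obtain ⟨k, hk⟩ : ∃ k, Nat.find (hr v) = k + 1 := by
      refine Nat.exists_eq_succ_of_ne_zero fun h => hv ?_
      have := Nat.find_spec (hr v)
      rw [h] at this
      exact this
    have h1 := Nat.find_spec (hr v)
    rw [hk] at h1
    obtain ⟨e, b, h1, h2⟩ := h1
    refine ⟨e, !b, fun _ => ⟨?_, h2⟩⟩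
    have h3 : Nat.find (hr (bd e b)) ≤ k := Nat.find_min' _ h1
    have h4 : Nat.find (hr v) ≤ Nat.find (hr (bd e b)) + 1 :=
      Nat.find_min' _ ⟨e, b, Nat.find_spec (hr (bd e b)), h2⟩
    simp only [Bool.not_not]
    omega
  choose e b h using hd
  exact ⟨fun v => Nat.find (hr v), fun v => bd (e v) (!(b v)), e,
    (Nat.find_eq_zero _).2 rfl, fun v hv => (h v hv).1, fun v hv => ⟨b v, (h v hv).2, rfl⟩⟩

/-- The path from `v` to the root meets every depth from `T.depth v` down to `0`. This bounds the
total depth, so that a maximum exists. -/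
theorem SpanTree.depth_lt_card [Fintype V] (T : SpanTree bd r) (v : V) :
    T.depth v < Fintype.card V := by
  classical
  have key : ∀ k v, T.depth v = k → Finset.range (k + 1) ⊆ Finset.univ.image T.depth := by
    intro k
    induction k with
    | zero =>
      intro v hv i hi
      simp only [zero_add, Finset.range_one, Finset.mem_singleton] at hi
      exact Finset.mem_image.2 ⟨v, Finset.mem_univ _, by omega⟩
    | succ k ih =>
      intro v hv i hi
      by_cases h : i = k + 1
      · exact Finset.mem_image.2 ⟨v, Finset.mem_univ _, by omega⟩
      · have hvr : v ≠ r := fun h => by have := T.depth_root; simp_all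
        have := T.depth_eq v hvr
        refine ih (T.parent v) (by omega) ?_
        simp only [Finset.mem_range] at hi ⊢
        omega
  have h1 := Finset.card_le_card (key _ v rfl)
  have h2 := Finset.card_image_le (s := Finset.univ) (f := T.depth)
  simp only [Finset.card_range, Finset.card_univ] at h1 h2
  omega

/-- A rooted spanning tree of maximal total depth: no edge outside of the tree joins two distinct
vertices without children. -/
theorem exists_spanTree_child [Finite V] [Nonempty E]
    (hconn : ∀ S : Set V, r ∈ S → (∀ e b, bd e b ∈ S → bd e (!b) ∈ S) → S = univ) :
    ∃ T : SpanTree bd r, ∀ f : E, bd f true ≠ bd f false → (∀ v, v ≠ r → T.edge v ≠ f) →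
      ∃ b z, z ≠ r ∧ T.parent z = bd f b := by
  classical
  have := Fintype.ofFinite V
  let A : Set ℕ := range fun T : SpanTree bd r => ∑ v, T.depth v
  have hA : A.Nonempty := by
    obtain ⟨T⟩ := exists_spanTree hconn
    exact ⟨_, T, rfl⟩
  have hb : BddAbove A := by
    refine ⟨∑ _v : V, Fintype.card V, ?_⟩
    rintro _ ⟨T, rfl⟩
    exact Finset.sum_le_sum fun v _ => (T.depth_lt_card v).le
  obtain ⟨T, hT⟩ : sSup A ∈ A := Nat.sSup_mem hA hb
  have hmax : ∀ T' : SpanTree bd r, ∑ v, T'.depth v ≤ ∑ v, T.depth v := fun T' =>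
    (le_csSup hb ⟨T', rfl⟩).trans hT.ge
  refine ⟨T, fun f hf hdel => ?_⟩
  by_contra! hno
  obtain ⟨b, hle⟩ : ∃ b, T.depth (bd f b) ≤ T.depth (bd f (!b)) := by
    rcases le_total (T.depth (bd f true)) (T.depth (bd f false)) with h | h
    · exact ⟨true, h⟩
    · exact ⟨false, h⟩
  have hne : bd f b ≠ bd f (!b) := by
    cases b
    · exact hf.symm
    · exact hf
  have hroot : ∀ v, v ≠ r → ∃ z, z ≠ r ∧ T.parent z = r := by
    have : ∀ k v, T.depth v = k → v ≠ r → ∃ z, z ≠ r ∧ T.parent z = r := by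
      intro k
      induction k with
      | zero => exact fun v hv hvr => by have := T.depth_eq v hvr; omega
      | succ k ih =>
        intro v hv hvr
        by_cases h : T.parent v = r
        · exact ⟨v, hvr, h⟩
        · exact ih _ (by have := T.depth_eq v hvr; omega) h
    exact fun v => this _ v rfl
  -- The root cannot be the childless end: as soon as there is another vertex, the root has a child.
  have hxr : bd f b ≠ r := by
    intro h
    obtain ⟨z, hz, hz'⟩ := hroot (bd f (!b)) (fun h' => hne (h.trans h'.symm))
    exact hno b z hz (hz'.trans h.symm)
  -- Rehang the shallower end of `f` below the other end. It has no children, so no other depth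
  -- changes, while its own depth grows.
  let T' : SpanTree bd r :=
    { depth := Function.update T.depth (bd f b) (T.depth (bd f (!b)) + 1)
      parent := Function.update T.parent (bd f b) (bd f (!b))
      edge := Function.update T.edge (bd f b) f
      depth_root := by rw [Function.update_of_ne hxr.symm, T.depth_root]
      depth_eq := by
        intro v hv
        by_cases h : v = bd f b
        · subst h
          simp [Function.update_of_ne hne.symm]
        · rw [Function.update_of_ne h, Function.update_of_ne h,
            Function.update_of_ne (hno b v hv), T.depth_eq v hv]
      ends := by
        intro v hv
        by_cases h : v = bd f b
        · subst h
          exact ⟨b, by simp⟩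
        · simpa [Function.update_of_ne h] using T.ends v hv }
  have := hmax T'
  refine absurd this (not_le.2 (Finset.sum_lt_sum (fun v _ => ?_) ⟨bd f b, Finset.mem_univ _, ?_⟩))
  · by_cases h : v = bd f b
    · subst h
      simp only [T', Function.update_self]
      omega
    · simp [T', Function.update_of_ne h]
  · simp only [T', Function.update_self]
    omega

/-- The degree of a vertex of a multigraph, loops counted twice. -/
noncomputable def mdeg (bd : E → Bool → V) (v : V) : ℕ :=
  Nat.card {p : E × Bool // bd p.1 p.2 = v}

theorem card_le_mdeg [Finite E] {v : V} (s : Finset E) (hs : ∀ e ∈ s, ∃ b, bd e b = v) :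
    s.card ≤ mdeg bd v := by
  choose b hb using hs
  have : Function.Injective (fun e : s => (⟨(e.1, b e.1 e.2), hb e.1 e.2⟩ :
      {p : E × Bool // bd p.1 p.2 = v})) := by
    intro e e' h
    simp only [Subtype.mk.injEq, Prod.mk.injEq] at h
    exact Subtype.ext h.1
  simpa [mdeg] using Nat.card_le_card_of_injective _ this

end Trees

/-! ### Cells of the unlabelled discretized configuration space and their matching -/

section Matching

variable {V E : Type*} {bd : E → Bool → V} {r : V}

/-- A rooted spanning tree together with a labelling of the vertices that increases away from the
root. -/
structure LabelledTree (bd : E → Bool → V) (r : V) where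
  label : V → ℕ
  parent : V → V
  edge : V → E
  label_inj : Function.Injective label
  label_lt : ∀ v, v ≠ r → label (parent v) < label v
  ends : ∀ v, v ≠ r → ∃ b, bd (edge v) b = v ∧ bd (edge v) (!b) = parent v

/-- Order the vertices by depth and break ties by an arbitrary enumeration; the pair is encoded in
base `card V`. -/
theorem SpanTree.exists_labelledTree [Finite V] (T : SpanTree bd r) :
    ∃ L : LabelledTree bd r, L.parent = T.parent ∧ L.edge = T.edge := by
  have := Fintype.ofFinite V
  let q := Fintype.equivFin V
  have hmul : ∀ {a b : ℕ} {x y : ℕ}, a < b → x < Fintype.card V →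
      a * Fintype.card V + x < b * Fintype.card V + y := by
    intro a b x y hab hx
    have : (a + 1) * Fintype.card V ≤ b * Fintype.card V := Nat.mul_le_mul_right _ hab
    rw [add_mul, one_mul] at this
    omega
  refine ⟨⟨fun v => T.depth v * Fintype.card V + q v, T.parent, T.edge, ?_, ?_, T.ends⟩, rfl, rfl⟩
  · intro v w h
    dsimp only at h
    rcases lt_trichotomy (T.depth v) (T.depth w) with h' | h' | h'
    · exact absurd h (hmul h' (q v).2).ne
    · rw [h'] at h
      exact q.injective (Fin.ext (by omega))
    · exact absurd h.symm (hmul h' (q w).2).ne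
  · intro v hv
    exact hmul (by have := T.depth_eq v hv; omega) (q _).2

/-- The vertex `w` lies on the closed cell `x` of the graph. -/
def Touches (bd : E → Bool → V) (w : V) : V ⊕ E → Prop
  | .inl v => v = w
  | .inr e => ∃ b, bd e b = w

/-- A set of `n` cells of the graph whose closures are pairwise disjoint. These index the cells of
the unlabelled discretized configuration space. -/
structure IsConf (bd : E → Bool → V) (n : ℕ) (s : Finset (V ⊕ E)) : Prop where
  card_eq : s.card = n
  eq_of_touches : ∀ x ∈ s, ∀ y ∈ s, ∀ w, Touches bd w x → Touches bd w y → x = y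

namespace LabelledTree

variable (L : LabelledTree bd r)

/-- The vertex `v` of the cell `s` can be moved along the edge to its parent. -/
def Unblocked (v : V) (s : Finset (V ⊕ E)) : Prop :=
  v ≠ r ∧ .inl v ∈ s ∧ ∀ x ∈ s, ¬ Touches bd (L.parent v) x

/-- The edge from `v` to its parent is an order-respecting edge of the cell `s`. -/
def Resp (v : V) (s : Finset (V ⊕ E)) : Prop :=
  v ≠ r ∧ .inr (L.edge v) ∈ s ∧
    ∀ w, .inl w ∈ s → w ≠ r → L.parent w = L.parent v → L.label v ≤ L.label w

/-- `v` has minimal label among the unblocked vertices and order-respecting edges. -/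
def IsMinimal (v : V) (s : Finset (V ⊕ E)) : Prop :=
  ∀ w, L.Unblocked w s ∨ L.Resp w s → L.label v ≤ L.label w

/-- The cell `s` is redundant, and is matched by moving `v` along its edge. -/
def RedAt (v : V) (s : Finset (V ⊕ E)) : Prop := L.Unblocked v s ∧ L.IsMinimal v s

/-- The cell `s` is collapsible, and is matched by moving the edge of `v` back to `v`. -/
def ColAt (v : V) (s : Finset (V ⊕ E)) : Prop := L.Resp v s ∧ L.IsMinimal v s

open scoped Classical in
/-- Replace the vertex `v` by the edge to its parent. -/
noncomputable def up (v : V) (s : Finset (V ⊕ E)) : Finset (V ⊕ E) :=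
  insert (.inr (L.edge v)) (s.erase (.inl v))

open scoped Classical in
/-- Replace the edge of `v` by `v`. -/
noncomputable def down (v : V) (s : Finset (V ⊕ E)) : Finset (V ⊕ E) :=
  insert (.inl v) (s.erase (.inr (L.edge v)))

variable {L} {n : ℕ} {s : Finset (V ⊕ E)} {v w : V}

theorem touches_edge (hv : v ≠ r) (w : V) :
    Touches bd w (.inr (L.edge v)) ↔ w = v ∨ w = L.parent v := by
  obtain ⟨b, h1, h2⟩ := L.ends v hv
  constructor
  · rintro ⟨b', rfl⟩
    cases b <;> cases b' <;> simp_all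
  · rintro (rfl | rfl)
    · exact ⟨b, h1⟩
    · exact ⟨!b, h2⟩

theorem parent_ne (hv : v ≠ r) : L.parent v ≠ v := fun h => by
  have := L.label_lt v hv
  rw [h] at this
  exact lt_irrefl _ this

/-- Two different vertices with the same tree edge would be parents of each other, and the labels
forbid this. -/
theorem edge_injOn (hv : v ≠ r) (hw : w ≠ r) (h : L.edge v = L.edge w) : v = w := by
  by_contra hne
  have h1 := (touches_edge (L := L) hv w).1 (by rw [h]; exact (touches_edge hw w).2 (.inl rfl))
  have h2 := (touches_edge (L := L) hw v).1 (by rw [← h]; exact (touches_edge hv v).2 (.inl rfl))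
  have h1 := h1.resolve_left (Ne.symm hne)
  have h2 := h2.resolve_left hne
  have h3 := L.label_lt v hv
  have h4 := L.label_lt w hw
  rw [← h1] at h3
  rw [← h2] at h4
  omega

theorem inr_notMem_of_inl_mem (hs : IsConf bd n s) (hv : v ≠ r) (h : .inl v ∈ s) :
    .inr (L.edge v) ∉ s := fun h' => by
  have := hs.eq_of_touches _ h _ h' v rfl ((touches_edge hv v).2 (.inl rfl))
  simp at this

theorem mem_up {x : V ⊕ E} : x ∈ L.up v s ↔ x = .inr (L.edge v) ∨ (x ≠ .inl v ∧ x ∈ s) := by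
  simp [up]

theorem mem_down {x : V ⊕ E} : x ∈ L.down v s ↔ x = .inl v ∨ (x ≠ .inr (L.edge v) ∧ x ∈ s) := by
  simp [down]

theorem Unblocked.down_up (hs : IsConf bd n s) (h : L.Unblocked v s) :
    L.down v (L.up v s) = s := by
  have := inr_notMem_of_inl_mem (L := L) hs h.1 h.2.1
  have := h.2.1
  ext x
  rw [mem_down, mem_up]
  by_cases h1 : x = .inl v <;> by_cases h2 : x = .inr (L.edge v) <;> simp_all

theorem Resp.up_down (hs : IsConf bd n s) (h : L.Resp v s) : L.up v (L.down v s) = s := by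
  have : .inl v ∉ s := fun h' => inr_notMem_of_inl_mem hs h.1 h' h.2.1
  have := h.2.1
  ext x
  rw [mem_up, mem_down]
  by_cases h1 : x = .inl v <;> by_cases h2 : x = .inr (L.edge v) <;> simp_all

theorem Unblocked.isConf_up (hs : IsConf bd n s) (h : L.Unblocked v s) :
    IsConf bd n (L.up v s) := by
  classical
  have hn := inr_notMem_of_inl_mem (L := L) hs h.1 h.2.1
  constructor
  · rw [up, Finset.card_insert_of_notMem (fun h' => hn (Finset.mem_of_mem_erase h')),
      Finset.card_erase_add_one h.2.1, hs.card_eq]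
  · have key : ∀ y, y ≠ .inl v → y ∈ s → ∀ w, Touches bd w (.inr (L.edge v)) →
        ¬ Touches bd w y := by
      intro y hy hys w hw hwy
      rcases (touches_edge h.1 w).1 hw with rfl | rfl
      · exact hy (hs.eq_of_touches _ hys _ h.2.1 w hwy rfl)
      · exact h.2.2 y hys hwy
    intro x hx y hy w hwx hwy
    rcases mem_up.1 hx with rfl | ⟨hx1, hx2⟩ <;> rcases mem_up.1 hy with rfl | ⟨hy1, hy2⟩
    · rfl
    · exact absurd hwy (key y hy1 hy2 w hwx)
    · exact absurd hwx (key x hx1 hx2 w hwy)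
    · exact hs.eq_of_touches x hx2 y hy2 w hwx hwy

theorem Resp.isConf_down (hs : IsConf bd n s) (h : L.Resp v s) : IsConf bd n (L.down v s) := by
  classical
  have hn : .inl v ∉ s := fun h' => inr_notMem_of_inl_mem hs h.1 h' h.2.1
  constructor
  · rw [down, Finset.card_insert_of_notMem (fun h' => hn (Finset.mem_of_mem_erase h')),
      Finset.card_erase_add_one h.2.1, hs.card_eq]
  · have key : ∀ y, y ≠ .inr (L.edge v) → y ∈ s → ∀ w, Touches bd w (.inl v) →
        ¬ Touches bd w y := by
      rintro y hy hys w hw hwy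
      exact hy (hs.eq_of_touches _ hys _ h.2.1 w hwy ((touches_edge h.1 w).2 (.inl hw.symm)))
    intro x hx y hy w hwx hwy
    rcases mem_down.1 hx with rfl | ⟨hx1, hx2⟩ <;> rcases mem_down.1 hy with rfl | ⟨hy1, hy2⟩
    · rfl
    · exact absurd hwy (key y hy1 hy2 w hwx)
    · exact absurd hwx (key x hx1 hx2 w hwy)
    · exact hs.eq_of_touches x hx2 y hy2 w hwx hwy

/-- The parent of `v` is free in `s`, so every sibling of `v` in `s` is unblocked and has a label at
least that of `v`; hence the new edge is order-respecting. A move of smaller label after the change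
would already have been available in `s`. -/
theorem RedAt.colAt_up (h : L.RedAt v s) : L.ColAt v (L.up v s) := by
  obtain ⟨⟨hv, hvs, hb⟩, hmin⟩ := h
  refine ⟨⟨hv, mem_up.2 (.inl rfl), fun w hw hwr hp => ?_⟩, fun w hw => ?_⟩
  · have hw' : .inl w ∈ s := ((mem_up.1 hw).resolve_left (by simp)).2
    exact hmin w (.inl ⟨hwr, hw', fun x hx => hp ▸ hb x hx⟩)
  · by_contra! hlt
    refine absurd (hmin w ?_) (not_le.2 hlt)
    rcases hw with ⟨hwr, hws, hwb⟩ | ⟨hwr, hws, hwb⟩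
    · left
      refine ⟨hwr, ((mem_up.1 hws).resolve_left (by simp)).2, fun x hx ht => ?_⟩
      by_cases hxv : x = .inl v
      · subst hxv
        exact hwb _ (mem_up.2 (.inl rfl)) ((touches_edge hv _).2 (.inl (Eq.symm ht)))
      · exact hwb x (mem_up.2 (.inr ⟨hxv, hx⟩)) ht
    · right
      refine ⟨hwr, ?_, fun x hx hxr hp => ?_⟩
      · rcases mem_up.1 hws with h' | h'
        · exact absurd hlt (by rw [edge_injOn hwr hv (by simpa using h')]; exact lt_irrefl _)
        · exact h'.2
      · by_cases hxv : x = v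
        · exact hxv ▸ hlt.le
        · exact hwb x (mem_up.2 (.inr ⟨by simpa using hxv, hx⟩)) hxr hp

/-- Shrinking the edge frees the parent of `v`, so the only vertices that can become unblocked are
`v` and its siblings; the siblings have larger labels because the edge was order-respecting. -/
theorem ColAt.redAt_down (hs : IsConf bd n s) (h : L.ColAt v s) : L.RedAt v (L.down v s) := by
  obtain ⟨⟨hv, hvs, hb⟩, hmin⟩ := h
  refine ⟨⟨hv, mem_down.2 (.inl rfl), fun x hx ht => ?_⟩, fun w hw => ?_⟩
  · rcases mem_down.1 hx with rfl | ⟨h1, h2⟩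
    · exact parent_ne hv (Eq.symm ht)
    · exact h1 (hs.eq_of_touches _ h2 _ hvs _ ht ((touches_edge hv _).2 (.inr rfl)))
  · by_contra! hlt
    have hwv : w ≠ v := fun h => by simp [h] at hlt
    refine absurd hlt (not_lt.2 ?_)
    rcases hw with ⟨hwr, hws, hwb⟩ | ⟨hwr, hws, hwb⟩
    · have hws' : .inl w ∈ s := ((mem_down.1 hws).resolve_left (by simpa using hwv)).2
      by_cases hp : L.parent w = L.parent v
      · exact hb w hws' hwr hp
      · refine hmin w (.inl ⟨hwr, hws', fun x hx ht => ?_⟩)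
        by_cases hxv : x = .inr (L.edge v)
        · subst hxv
          rcases (touches_edge hv _).1 ht with h' | h'
          · exact hwb (.inl v) (mem_down.2 (.inl rfl)) h'.symm
          · exact hp h'
        · exact hwb x (mem_down.2 (.inr ⟨hxv, hx⟩)) ht
    · refine hmin w (.inr ⟨hwr, ((mem_down.1 hws).resolve_left (by simp)).2, fun x hx hxr hp => ?_⟩)
      exact hwb x (mem_down.2 (.inr ⟨by simp, hx⟩)) hxr hp

/-- Injectivity of the labels makes the least move unique, so the matching is well defined. -/
theorem eq_of_isMinimal (h1 : L.Unblocked v s ∨ L.Resp v s) (h1' : L.IsMinimal v s)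
    (h2 : L.Unblocked w s ∨ L.Resp w s) (h2' : L.IsMinimal w s) : v = w :=
  L.label_inj (le_antisymm (h1' w h2) (h2' v h1))

theorem RedAt.not_colAt (hs : IsConf bd n s) (h : L.RedAt v s) : ¬ L.ColAt w s := fun h' => by
  obtain rfl := eq_of_isMinimal (.inl h.1) h.2 (.inr h'.1) h'.2
  exact inr_notMem_of_inl_mem hs h.1.1 h.1.2.1 h'.1.2.1

theorem exists_redAt_or_colAt (h : ∃ v, L.Unblocked v s ∨ L.Resp v s) :
    ∃ v, L.RedAt v s ∨ L.ColAt v s := by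
  let A : Set V := {v | L.Unblocked v s ∨ L.Resp v s}
  refine ⟨Function.argminOn L.label A h, ?_⟩
  have hmin : L.IsMinimal (Function.argminOn L.label A h) s := fun w hw =>
    Function.argminOn_le L.label A hw
  rcases (Function.argminOn_mem L.label A h : _ ∈ A) with h' | h'
  · exact .inl ⟨h', hmin⟩
  · exact .inr ⟨h', hmin⟩

theorem card_toRight_up (hs : IsConf bd n s) (h : L.Unblocked v s) :
    (L.up v s).toRight.card = s.toRight.card + 1 := by
  classical
  have : (L.up v s).toRight = insert (L.edge v) s.toRight := by
    ext e
    simp [mem_up]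
  rw [this, Finset.card_insert_of_notMem]
  simpa using inr_notMem_of_inl_mem (L := L) hs h.1 h.2.1

end LabelledTree

end Matching

/-! ### Faces of cubical cells -/

section Faces

variable {V E : Type*} {bd : E → Bool → V} {n : ℕ} {s t : Finset (V ⊕ E)}

open scoped Classical in
/-- `t` is obtained from `s` by replacing some of the edges of `s` by one of their ends. -/
def IsFace (bd : E → Bool → V) (t s : Finset (V ⊕ E)) : Prop :=
  ∃ g : V ⊕ E → V ⊕ E, (∀ x ∈ s, g x = x ∨ ∃ e b, x = .inr e ∧ g x = .inl (bd e b)) ∧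
    t = s.image g

theorem IsFace.toRight_subset (h : IsFace bd t s) : t.toRight ⊆ s.toRight := by
  obtain ⟨g, hg, rfl⟩ := h
  intro e he
  obtain ⟨x, hx, hxe⟩ := by simpa only [Finset.mem_toRight, Finset.mem_image] using he
  rcases hg x hx with h | ⟨e', b, -, h⟩
  · rw [Finset.mem_toRight, ← hxe, h]
    exact hx
  · simp [h] at hxe

/-- Shrinking an edge to one of its ends shrinks its closure, so closures stay disjoint; in
particular no two cells become equal, and the cardinality survives. -/
theorem IsFace.isConf (hs : IsConf bd n s) (h : IsFace bd t s) : IsConf bd n t := by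
  classical
  obtain ⟨g, hg, rfl⟩ := h
  have ht : ∀ x ∈ s, ∀ w, Touches bd w (g x) → Touches bd w x := by
    intro x hx w hw
    rcases hg x hx with h | ⟨e, b, rfl, h⟩
    · rwa [h] at hw
    · rw [h] at hw
      exact ⟨b, hw⟩
  have hex : ∀ x, ∃ w, Touches bd w x := by
    rintro (v | e)
    · exact ⟨v, rfl⟩
    · exact ⟨_, true, rfl⟩
  constructor
  · rw [Finset.card_image_of_injOn, hs.card_eq]
    intro x hx y hy hxy
    obtain ⟨w, hw⟩ := hex (g x)
    exact hs.eq_of_touches x hx y hy w (ht x hx w hw) (ht y hy w (hxy ▸ hw))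
  · intro x hx y hy w hwx hwy
    obtain ⟨x, hx', rfl⟩ := Finset.mem_image.1 hx
    obtain ⟨y, hy', rfl⟩ := Finset.mem_image.1 hy
    rw [hs.eq_of_touches x hx' y hy' w (ht x hx' w hwx) (ht y hy' w hwy)]

theorem IsFace.trans {u : Finset (V ⊕ E)} (h : IsFace bd t s) (h' : IsFace bd s u) :
    IsFace bd t u := by
  classical
  obtain ⟨g, hg, rfl⟩ := h
  obtain ⟨g', hg', rfl⟩ := h'
  refine ⟨g ∘ g', fun x hx => ?_, by rw [Finset.image_image]⟩
  have h1 := hg _ (Finset.mem_image_of_mem _ hx)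
  rcases hg' x hx with h | ⟨e, b, h, h'⟩
  · simpa only [Function.comp_apply, h] using h1
  · refine .inr ⟨e, b, h, ?_⟩
    rcases h1 with h1 | ⟨e', b', h1, -⟩
    · exact h1.trans h'
    · simp [h'] at h1

open scoped Classical in
theorem isFace_insert_erase {e : E} (b : Bool) (he : .inr e ∈ s) :
    IsFace bd (insert (.inl (bd e b)) (s.erase (.inr e))) s := by
  refine ⟨fun x => if x = .inr e then .inl (bd e b) else x, fun x hx => ?_, ?_⟩
  · by_cases hxe : x = .inr e
    · exact .inr ⟨e, b, hxe, if_pos hxe⟩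
    · exact .inl (if_neg hxe)
  · ext y
    simp only [Finset.mem_insert, Finset.mem_erase, Finset.mem_image]
    constructor
    · rintro (rfl | ⟨h1, h2⟩)
      · exact ⟨_, he, if_pos rfl⟩
      · exact ⟨y, h2, if_neg h1⟩
    · rintro ⟨x, hx, rfl⟩
      by_cases hxe : x = .inr e
      · exact .inl (if_pos hxe)
      · rw [if_neg hxe]
        exact .inr ⟨hxe, hx⟩

theorem IsFace.apply_eq {g : V ⊕ E → V ⊕ E}
    (hg : ∀ x ∈ s, g x = x ∨ ∃ e b, x = .inr e ∧ g x = .inl (bd e b)) {e : E}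
    (h : ∃ y ∈ s, g y = .inr e) : g (.inr e) = .inr e := by
  obtain ⟨y, hy, hye⟩ := h
  rcases hg y hy with h | ⟨e', b, -, h⟩
  · rwa [← hye, h]
  · simp [h] at hye

/-- The edges of a face are exactly the edges of `s` that were not shrunk, so a face of full
dimension shrinks nothing. -/
theorem IsFace.eq_of_card_le (h : IsFace bd t s) (hc : s.toRight.card ≤ t.toRight.card) :
    t = s := by
  classical
  have heq := Finset.eq_of_subset_of_card_le h.toRight_subset hc
  obtain ⟨g, hg, rfl⟩ := h
  have : ∀ x ∈ s, g x = x := by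
    intro x hx
    rcases x with v | e
    · rcases hg _ hx with h | ⟨e', b, h, -⟩
      · exact h
      · simp at h
    · refine IsFace.apply_eq hg ?_
      have : e ∈ (s.image g).toRight := by rw [heq]; simpa using hx
      simpa only [Finset.mem_toRight, Finset.mem_image] using this
  ext y
  rw [Finset.mem_image]
  exact ⟨fun ⟨x, hx, h⟩ => by rwa [← h, this x hx], fun hy => ⟨y, hy, this y hy⟩⟩

open scoped Classical in
theorem IsFace.exists_of_card_eq (h : IsFace bd t s) (hc : s.toRight.card = t.toRight.card + 1) :
    ∃ e b, .inr e ∈ s ∧ t = insert (.inl (bd e b)) (s.erase (.inr e)) := by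
  have hsd : (s.toRight \ t.toRight).card = 1 := by
    rw [Finset.card_sdiff_of_subset h.toRight_subset]
    omega
  obtain ⟨e, he⟩ := Finset.card_eq_one.1 hsd
  obtain ⟨g, hg, rfl⟩ := h
  have hes : e ∈ s.toRight \ (s.image g).toRight := by rw [he]; simp
  have hes' : .inr e ∈ s := by
    rw [Finset.mem_sdiff] at hes
    simpa using hes.1
  obtain ⟨b, hb⟩ : ∃ b, g (.inr e) = .inl (bd e b) := by
    rcases hg _ hes' with h | ⟨e', b, h, h'⟩
    · rw [Finset.mem_sdiff, Finset.mem_toRight (u := s.image g)] at hes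
      exact absurd (Finset.mem_image.2 ⟨_, hes', h⟩) hes.2
    · obtain rfl : e = e' := by simpa using h
      exact ⟨b, h'⟩
  refine ⟨e, b, hes', ?_⟩
  have : ∀ x ∈ s.erase (.inr e), g x = x := by
    intro x hx
    obtain ⟨hxe, hx⟩ := Finset.mem_erase.1 hx
    rcases x with v | e'
    · rcases hg _ hx with h | ⟨e', b, h, -⟩
      · exact h
      · simp at h
    · refine IsFace.apply_eq hg ?_
      have h1 : e' ∉ s.toRight \ (s.image g).toRight := by
        rw [he]
        simpa using hxe
      rw [Finset.mem_sdiff, not_and_not_right] at h1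
      simpa only [Finset.mem_toRight, Finset.mem_image] using h1 (by simpa using hx)
  rw [← Finset.insert_erase hes', Finset.image_insert, hb, Finset.erase_insert (by simp)]
  congr 1
  ext y
  rw [Finset.mem_image]
  exact ⟨fun ⟨x, hx, h⟩ => by rwa [← h, this x hx], fun hy => ⟨y, hy, this y hy⟩⟩

end Faces

/-! ### Acyclicity of the matching and the sequence of collapses -/

section Acyclic

variable {V E : Type*} {bd : E → Bool → V} {r : V} {n : ℕ} {s t : Finset (V ⊕ E)} {v w : V}

namespace LabelledTree

variable (L : LabelledTree bd r)

/-- The largest label of a vertex of a closed cell of the graph. -/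
def topLabel : V ⊕ E → ℕ
  | .inl v => L.label v
  | .inr e => max (L.label (bd e true)) (L.label (bd e false))

open scoped Classical in
/-- The edges of `s` outside of the tree. -/
noncomputable def deleted (s : Finset (V ⊕ E)) : Finset E :=
  s.toRight.filter fun e => ∀ v, v ≠ r → L.edge v ≠ e

open scoped Classical in
/-- The label of the pivot of a redundant cell. -/
noncomputable def pivotLabel (s : Finset (V ⊕ E)) : ℕ :=
  if h : ∃ v, L.RedAt v s then L.label h.choose else 0

/-- The quantity that increases along gradient paths. -/
noncomputable def height (s : Finset (V ⊕ E)) : ℕ ×ₗ ℕ ×ₗ ℕ ×ₗ ℕ :=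
  toLex (s.toRight.card, toLex (∑ x ∈ s, L.topLabel x,
    toLex ((L.deleted s).card, L.pivotLabel s)))

variable {L}

theorem RedAt.pivotLabel_eq (h : L.RedAt v s) : L.pivotLabel s = L.label v := by
  have h' : ∃ v, L.RedAt v s := ⟨v, h⟩
  rw [pivotLabel, dif_pos h', eq_of_isMinimal (.inl h'.choose_spec.1) h'.choose_spec.2
    (.inl h.1) h.2]

theorem topLabel_edge (hv : v ≠ r) : L.topLabel (.inr (L.edge v)) = L.label v := by
  obtain ⟨b, h1, h2⟩ := L.ends v hv
  have := L.label_lt v hv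
  cases b <;> simp only [Bool.not_true, Bool.not_false] at h1 h2 <;>
    simp only [topLabel, h1, h2] <;> omega

theorem label_le_topLabel (e : E) (b : Bool) : L.label (bd e b) ≤ L.topLabel (.inr e) := by
  cases b <;> simp [topLabel]

/-- The label of a tree edge is that of its end away from the root, which is the vertex it replaces.
-/
theorem sum_up (hs : IsConf bd n s) (h : L.Unblocked v s) :
    ∑ x ∈ L.up v s, L.topLabel x = ∑ x ∈ s, L.topLabel x := by
  classical
  have hn := inr_notMem_of_inl_mem (L := L) hs h.1 h.2.1
  rw [up, Finset.sum_insert (fun h' => hn (Finset.mem_of_mem_erase h')), topLabel_edge h.1]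
  exact Finset.add_sum_erase s L.topLabel h.2.1

theorem deleted_up (h : L.Unblocked v s) : L.deleted (L.up v s) = L.deleted s := by
  ext e
  simp only [deleted, Finset.mem_filter, Finset.mem_toRight, mem_up]
  constructor
  · rintro ⟨h1 | h1, h2⟩
    · exact absurd (by simpa using h1.symm) (h2 v h.1)
    · exact ⟨h1.2, h2⟩
  · rintro ⟨h1, h2⟩
    exact ⟨.inr ⟨by simp, h1⟩, h2⟩

open scoped Classical in
/-- The height increases along gradient paths, so the matching is acyclic. -/
theorem height_lt (hloop : ∀ e, .inr e ∈ L.up v s → bd e true ≠ bd e false)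
    (hs : IsConf bd n s) (h : L.RedAt v s) {e : E} {b : Bool}
    (he : .inr e ∈ L.up v s) (ht : t = insert (.inl (bd e b)) ((L.up v s).erase (.inr e)))
    (htr : L.RedAt w t) (hne : t ≠ s) (hcard : t.toRight.card = s.toRight.card) :
    L.height t < L.height s := by
  have hup := h.1.isConf_up hs
  have hcol := h.colAt_up
  have hsum : ∑ x ∈ t, L.topLabel x + L.topLabel (.inr e) =
      ∑ x ∈ s, L.topLabel x + L.label (bd e b) := by
    rw [← sum_up hs h.1, ← Finset.add_sum_erase _ L.topLabel he, ht, Finset.sum_insert]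
    · simp only [topLabel]
      ring
    · intro h'
      have := hup.eq_of_touches _ (Finset.mem_of_mem_erase h') _ he (bd e b) rfl ⟨b, rfl⟩
      simp at this
  have hle := L.label_le_topLabel e b
  rw [height, height, hcard, Prod.Lex.toLex_lt_toLex]
  refine .inr ⟨rfl, ?_⟩
  dsimp only
  rw [Prod.Lex.toLex_lt_toLex]
  rcases hle.lt_or_eq with hlt | heq
  · left
    dsimp only
    omega
  refine .inr ⟨by dsimp only; omega, ?_⟩
  dsimp only
  rw [Prod.Lex.toLex_lt_toLex]
  -- From here on `e` is replaced by its end of larger label. For the edge of `v` this would lead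
  -- back to `s`.
  have hev : e ≠ L.edge v := by
    rintro rfl
    have : bd (L.edge v) b = v := by
      rw [topLabel_edge h.1.1] at heq
      exact L.label_inj heq
    rw [this] at ht
    exact hne (by rw [ht]; exact h.1.down_up hs)
  have hdel : L.deleted t = (L.deleted s).erase e := by
    rw [← deleted_up h.1]
    ext f
    simp only [deleted, ht, Finset.mem_filter, Finset.mem_toRight, Finset.mem_insert,
      Finset.mem_erase, reduceCtorEq, false_or, ne_eq, Sum.inr.injEq]
    tauto
  by_cases hed : e ∈ L.deleted s
  · left
    dsimp only
    rw [hdel]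
    exact Finset.card_erase_lt_of_mem hed
  rw [Finset.erase_eq_of_notMem hed] at hdel
  right
  dsimp only
  refine ⟨by rw [hdel], ?_⟩
  rw [h.pivotLabel_eq, htr.pivotLabel_eq]
  obtain ⟨u, hu, hue⟩ : ∃ u, u ≠ r ∧ L.edge u = e := by
    by_contra! hno
    refine hed ?_
    rw [← deleted_up h.1]
    simp only [deleted, Finset.mem_filter, Finset.mem_toRight]
    exact ⟨he, hno⟩
  have hub : bd e b = u := by
    rw [← hue, topLabel_edge hu, hue] at heq
    exact L.label_inj heq
  have hvt : .inr (L.edge v) ∈ t := by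
    rw [ht]
    exact Finset.mem_insert_of_mem (Finset.mem_erase.2 ⟨by simpa using hev.symm, hcol.1.2.1⟩)
  -- The new vertex `u` is no sibling of `v`, since the disjoint edges of `u` and `v` would then
  -- share the parent. So the edge of `v` stays order-respecting in `t`, and the pivot of `t` has a
  -- smaller label.
  have hresp : L.Resp v t := by
    refine ⟨h.1.1, hvt, fun x hx hxr hp => ?_⟩
    rw [ht, Finset.mem_insert, Finset.mem_erase] at hx
    rcases hx with hx | ⟨-, hx⟩
    · obtain rfl : x = u := by rw [← hub]; simpa using hx
      refine absurd (hup.eq_of_touches _ he _ hcol.1.2.1 (L.parent v) ?_ ?_) (by simpa using hev)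
      · rw [← hue, touches_edge hu, hp]
        exact .inr rfl
      · exact (touches_edge h.1.1 _).2 (.inr rfl)
    · exact hcol.1.2.2 x hx hxr hp
  refine lt_of_le_of_ne (htr.2 v (.inr hresp)) fun h' => ?_
  obtain rfl := L.label_inj h'
  have htc : IsConf bd n t := IsFace.isConf hup (ht ▸ isFace_insert_erase b he)
  exact inr_notMem_of_inl_mem htc h.1.1 htr.1.2.1 hvt

/-- The cells that remain after all cells of dimension above `k` have been collapsed. -/
def core (L : LabelledTree bd r) (n : ℕ) (k : ℤ) : Set (Finset (V ⊕ E)) :=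
  {s | IsConf bd n s ∧ (s.toRight.card : ℤ) ≤ k ∧
    ∀ v, L.RedAt v s → (s.toRight.card : ℤ) + 1 ≤ k}

/-- If there are no critical cells of dimension above `k`, then the complex of all cells collapses
onto the subcomplex `core L n k`: a property of subcomplexes that holds for the whole complex and
is inherited under elementary collapses holds for `core L n k`. -/
theorem collapse_induction [Finite V] [Finite E] {k : ℤ}
    (hloop : ∀ s, IsConf bd n s → ∀ e, .inr e ∈ s → bd e true ≠ bd e false)
    (hcrit : ∀ s, IsConf bd n s → (∀ v, ¬ L.Resp v s) → (s.toRight.card : ℤ) ≤ k)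
    (P : Set (Finset (V ⊕ E)) → Prop) (h0 : P {s | IsConf bd n s})
    (hstep : ∀ K : Set (Finset (V ⊕ E)), (∀ s ∈ K, IsConf bd n s) →
      (∀ s ∈ K, ∀ t, IsFace bd t s → t ∈ K) →
      ∀ a v, a ∈ K → L.up v a ∈ K → L.Unblocked v a →
        (∀ s ∈ K, ∀ t, IsFace bd t s → t ∈ ({a, L.up v a} : Set _) →
          s ∈ ({a, L.up v a} : Set _)) → P K → P (K \ {a, L.up v a})) :
    P (L.core n k) := by
  -- Induction on the number of remaining cells, keeping `K` closed under faces and a union of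
  -- complete matched pairs and critical cells, and containing the core.
  have aux : ∀ m : ℕ, ∀ K : Set (Finset (V ⊕ E)), K.ncard = m → (∀ s ∈ K, IsConf bd n s) →
      (∀ s ∈ K, ∀ t, IsFace bd t s → t ∈ K) →
      (∀ s v, IsConf bd n s → L.RedAt v s → (s ∈ K ↔ L.up v s ∈ K)) → L.core n k ⊆ K →
      P K → P (L.core n k) := by
    intro m
    induction m using Nat.strong_induction_on with
    | _ m ih =>
    intro K hm hK hlow hpair hsub hP
    by_cases hKY : K ⊆ L.core n k
    · rwa [← hKY.antisymm hsub]
    have hup_core : ∀ s v, IsConf bd n s → L.RedAt v s → s ∉ L.core n k →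
        L.up v s ∉ L.core n k := by
      intro s v hs hv hsY hY
      have := hY.2.1
      rw [card_toRight_up hs hv.1] at this
      refine hsY ⟨hs, by push_cast at this; omega, fun _ _ => by exact_mod_cast this⟩
    let A : Set (Finset (V ⊕ E)) := {s | s ∈ K ∧ s ∉ L.core n k ∧ ∃ v, L.RedAt v s}
    have hdown : ∀ s ∈ K, s ∉ L.core n k → (¬ ∃ v, L.RedAt v s) → ∃ v, L.ColAt v s := by
      intro s hs hsY hr
      have h1 : ¬ (s.toRight.card : ℤ) ≤ k := fun h =>
        hsY ⟨hK s hs, h, fun v hv => absurd ⟨v, hv⟩ hr⟩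
      have h2 : ∃ v, L.Resp v s := by
        by_contra! hno
        exact h1 (hcrit s (hK s hs) hno)
      obtain ⟨v, hv⟩ := exists_redAt_or_colAt (L := L) ⟨h2.choose, .inr h2.choose_spec⟩
      exact ⟨v, hv.resolve_left fun h => hr ⟨v, h⟩⟩
    have hdown' : ∀ s ∈ K, ∀ v, L.ColAt v s → L.down v s ∈ K := by
      intro s hs v hv
      rw [hpair _ v (hv.1.isConf_down (hK s hs)) (hv.redAt_down (hK s hs)),
        hv.1.up_down (hK s hs)]
      exact hs
    have hdowncard : ∀ s ∈ K, ∀ v, L.ColAt v s → s.toRight.card = (L.down v s).toRight.card + 1 := by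
      intro s hs v hv
      have h1 := hv.redAt_down (hK s hs)
      have h2 := card_toRight_up (hv.1.isConf_down (hK s hs)) h1.1
      rwa [hv.1.up_down (hK s hs)] at h2
    have hdownY : ∀ s ∈ K, ∀ v, L.ColAt v s → s ∉ L.core n k → L.down v s ∉ L.core n k := by
      intro s hs v hv hsY hY
      have h1 := hv.redAt_down (hK s hs)
      have h2 := hdowncard s hs v hv
      have h3 := hY.2.2 v h1
      refine hsY ⟨hK s hs, by push_cast [h2]; exact h3, fun w hw =>
        absurd hv (hw.not_colAt (hK s hs))⟩
    have hA : A.Nonempty := by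
      obtain ⟨s, hs, hsY⟩ := not_subset.1 hKY
      by_cases hr : ∃ v, L.RedAt v s
      · exact ⟨s, hs, hsY, hr⟩
      · obtain ⟨v, hv⟩ := hdown s hs hsY hr
        exact ⟨L.down v s, hdown' s hs v hv, hdownY s hs v hv hsY, v, hv.redAt_down (hK s hs)⟩
    obtain ⟨a, ⟨haK, haY, v, hv⟩, hmax⟩ := Set.exists_max_image A L.height (Set.toFinite A) hA
    have hac := hK a haK
    have hbK := (hpair a v hac hv).1 haK
    have hbcard := card_toRight_up hac hv.1
    -- Another coface `s` would have larger dimension than `a`. By maximality it is not redundant,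
    -- and it is not critical since its dimension exceeds `k`; so it has a redundant partner. That
    -- partner has the dimension of `a`, and `height_lt` makes it higher than `a`, a contradiction.
    have htop : ∀ s ∈ K, IsFace bd a s → s = a ∨ s = L.up v a := by
      intro s hs has
      by_contra! hne
      have h1 : a.toRight.card < s.toRight.card := by
        by_contra! h
        exact hne.1 (has.eq_of_card_le h).symm
      have hsY : s ∉ L.core n k := fun hY => haY
        ⟨hac, by have := hY.2.1; omega, fun _ _ => by have := hY.2.1; omega⟩
      have hsr : ¬ ∃ v, L.RedAt v s := fun hr => by
        have := hmax s ⟨hs, hsY, hr⟩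
        rw [height, height, Prod.Lex.toLex_le_toLex] at this
        dsimp only at this
        omega
      obtain ⟨w, hw⟩ := hdown s hs hsY hsr
      have hd := hdowncard s hs w hw
      have hdA : L.height (L.down w s) ≤ L.height a := hmax _
        ⟨hdown' s hs w hw, hdownY s hs w hw hsY, w, hw.redAt_down (hK s hs)⟩
      have hc : a.toRight.card = (L.down w s).toRight.card := by
        have := hdA
        rw [height, height, Prod.Lex.toLex_le_toLex] at this
        dsimp only at this
        omega
      obtain ⟨e, b, he, hab⟩ := has.exists_of_card_eq (by omega)
      rw [← hw.1.up_down (hK s hs)] at he hab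
      refine absurd (height_lt (fun e' he' => hloop s (hK s hs) e' ?_)
        (hw.1.isConf_down (hK s hs)) (hw.redAt_down (hK s hs)) he hab hv ?_ hc) (not_lt.2 hdA)
      · rwa [hw.1.up_down (hK s hs)] at he'
      · intro h
        have h2 := hw.1.up_down (hK s hs)
        rw [← h] at h2
        have h3 := hw.redAt_down (hK s hs)
        rw [← h] at h3
        rw [eq_of_isMinimal (.inl h3.1) h3.2 (.inl hv.1) hv.2] at h2
        exact hne.2 h2.symm
    have hab : IsFace bd a (L.up v a) := by
      obtain ⟨b, hb, -⟩ := L.ends v hv.1.1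
      have := isFace_insert_erase (bd := bd) b (mem_up.2 (.inl rfl) : .inr (L.edge v) ∈ L.up v a)
      rw [hb] at this
      nth_rw 1 [← hv.1.down_up hac]
      exact this
    have hfree : ∀ s ∈ K, ∀ t, IsFace bd t s → t ∈ ({a, L.up v a} : Set _) →
        s ∈ ({a, L.up v a} : Set _) := by
      rintro s hs t hts (rfl | rfl)
      · exact htop s hs hts
      · exact htop s hs (hab.trans hts)
    refine ih _ ?_ (K \ {a, L.up v a}) rfl (fun s hs => hK s hs.1) ?_ ?_ ?_
      (hstep K hK hlow a v haK hbK hv.1 hfree hP)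
    · rw [← hm]
      exact Set.ncard_lt_ncard ⟨sdiff_subset, fun h => (h haK).2 (.inl rfl)⟩
    · exact fun s hs t hts => ⟨hlow s hs.1 t hts, fun h => hs.2 (hfree s hs.1 t hts h)⟩
    · intro s w hs hw
      have key : s ∈ ({a, L.up v a} : Set _) ↔ L.up w s ∈ ({a, L.up v a} : Set _) := by
        constructor
        · rintro (rfl | rfl)
          · rw [eq_of_isMinimal (.inl hw.1) hw.2 (.inl hv.1) hv.2]
            exact .inr rfl
          · exact absurd (hv.colAt_up) (hw.not_colAt hs)
        · rintro (h | h)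
          · rw [← h] at hv
            exact absurd (hw.colAt_up) (hv.not_colAt (h ▸ hac))
          · have h1 := hw.colAt_up
            have h2 := hv.colAt_up
            rw [mem_singleton_iff] at h
            rw [h] at h1
            have h3 := eq_of_isMinimal (.inr h1.1) h1.2 (.inr h2.1) h2.2
            left
            rw [← hw.1.down_up hs, h, h3, hv.1.down_up hac]
      rw [mem_sdiff, mem_sdiff, hpair s w hs hw, key]
    · intro s hs
      refine ⟨hsub hs, ?_⟩
      rintro (rfl | rfl)
      · exact haY hs
      · exact hup_core a v hac hv haY hs
  refine aux _ {s | IsConf bd n s} rfl (fun s hs => hs) (fun s hs t hts => hts.isConf hs)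
    (fun s v hs hv => ⟨fun _ => hv.1.isConf_up hs, fun _ => hs⟩) (fun s hs => hs.1) h0

end LabelledTree

end Acyclic

/-! ### Dimension bounds for cells without order-respecting edges -/

section Bounds

variable {V E : Type*} {bd : E → Bool → V} {r : V} {n : ℕ} {s : Finset (V ⊕ E)}

namespace LabelledTree

variable {L : LabelledTree bd r}

theorem mem_deleted {e : E} :
    e ∈ L.deleted s ↔ .inr e ∈ s ∧ ∀ v, v ≠ r → L.edge v ≠ e := by
  simp [deleted]

theorem exists_of_not_resp (hcrit : ∀ v, ¬ L.Resp v s) {v : V} (hv : v ≠ r)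
    (hs : .inr (L.edge v) ∈ s) :
    ∃ w, .inl w ∈ s ∧ w ≠ r ∧ w ≠ v ∧ L.parent w = L.parent v := by
  by_contra! hno
  refine hcrit v ⟨hv, hs, fun w hw hwr hp => ?_⟩
  by_cases h : w = v
  · rw [h]
  · exact absurd hp (hno w hw hwr h)

/-- The tree uses `card V - 1` distinct edges, none of which is counted as deleted. -/
theorem card_deleted_add_card_le [Fintype V] [Fintype E] :
    (L.deleted s).card + Fintype.card V ≤ Fintype.card E + 1 := by
  classical
  have h1 : ((Finset.univ.erase r).image L.edge).card = Fintype.card V - 1 := by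
    rw [Finset.card_image_of_injOn, Finset.card_erase_of_mem (Finset.mem_univ _),
      Finset.card_univ]
    intro v hv w hw h
    exact edge_injOn (Finset.ne_of_mem_erase hv) (Finset.ne_of_mem_erase hw) h
  have h2 : Disjoint (L.deleted s) ((Finset.univ.erase r).image L.edge) := by
    rw [Finset.disjoint_left]
    intro e he he'
    obtain ⟨v, hv, rfl⟩ := Finset.mem_image.1 he'
    exact (mem_deleted.1 he).2 v (Finset.ne_of_mem_erase hv) rfl
  have h3 := Finset.card_le_univ (L.deleted s ∪ (Finset.univ.erase r).image L.edge)
  rw [Finset.card_union_of_disjoint h2, h1] at h3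
  have : 0 < Fintype.card V := Fintype.card_pos_iff.2 ⟨r⟩
  omega

/-- The dimension of a critical cell is bounded in terms of the Euler characteristic. -/
theorem two_mul_card_toRight_le [Fintype V] [Fintype E] (hs : IsConf bd n s)
    (hcrit : ∀ v, ¬ L.Resp v s) :
    2 * s.toRight.card + Fintype.card V ≤ n + Fintype.card E + 1 := by
  classical
  have h1 := L.card_deleted_add_card_le (s := s)
  -- Each tree edge is assigned a vertex of `s` that holds it back. A vertex serves only one edge,
  -- since at most one edge of `s` can touch its parent.
  have h2 : (s.toRight \ L.deleted s).card ≤ s.toLeft.card := by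
    refine Finset.card_le_card_of_forall_subsingleton
      (fun e w => w ≠ r ∧ e ∈ s.toRight ∧ Touches bd (L.parent w) (.inr e)) ?_ ?_
    · intro e he
      obtain ⟨he, hd⟩ := Finset.mem_sdiff.1 he
      obtain ⟨v, hv, rfl⟩ : ∃ v, v ≠ r ∧ L.edge v = e := by
        by_contra! hno
        exact hd (mem_deleted.2 ⟨Finset.mem_toRight.1 he, hno⟩)
      obtain ⟨w, hw, hwr, -, hp⟩ := exists_of_not_resp hcrit hv (Finset.mem_toRight.1 he)
      exact ⟨w, Finset.mem_toLeft.2 hw, hwr, he, (touches_edge hv _).2 (.inr hp)⟩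
    · rintro w - e ⟨-, -, he, hte⟩ f ⟨-, -, hf, htf⟩
      simpa using hs.eq_of_touches _ (Finset.mem_toRight.1 he) _ (Finset.mem_toRight.1 hf) _ hte htf
  have h3 : (L.deleted s).card + (s.toRight \ L.deleted s).card = s.toRight.card := by
    rw [add_comm, Finset.card_sdiff_add_card_eq_card
      fun e he => Finset.mem_toRight.2 (mem_deleted.1 he).1]
  have h4 := Finset.card_toLeft_add_card_toRight (u := s)
  rw [hs.card_eq] at h4
  omega

/-- Away from the root, `f`, the edge to the child and the edge to the parent are three distinct
edges at `v`. At the root only two are available, and the third end comes from the degree not being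
`2`. -/
theorem three_le_mdeg [Finite E] {v z : V} {f : E} (hr : mdeg bd r ≠ 2) (hz : z ≠ r)
    (hzv : L.parent z = v) (hf : ∃ b, bd f b = v) (h1 : f ≠ L.edge z)
    (h2 : v ≠ r → f ≠ L.edge v) : 3 ≤ mdeg bd v := by
  classical
  have hze : ∃ b, bd (L.edge z) b = v := (touches_edge hz v).2 (.inr hzv.symm)
  by_cases hv : v = r
  · have := card_le_mdeg (bd := bd) (v := v) {f, L.edge z} (by
      intro e he
      rcases Finset.mem_insert.1 he with rfl | he
      · exact hf
      · rwa [Finset.mem_singleton.1 he])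
    rw [Finset.card_pair h1, hv] at this
    rw [hv]
    omega
  · have hne : L.edge z ≠ L.edge v := fun h =>
      parent_ne (L := L) hz (hzv.trans (edge_injOn hz hv h).symm)
    rw [← Finset.card_eq_three.2 ⟨f, L.edge z, L.edge v, h1, h2 hv, hne, rfl⟩]
    refine card_le_mdeg _ fun e he => ?_
    simp only [Finset.mem_insert, Finset.mem_singleton] at he
    rcases he with rfl | rfl | rfl
    · exact hf
    · exact hze
    · exact (touches_edge hv v).2 (.inl rfl)

/-- The dimension of a critical cell is bounded by the number of essential vertices. -/
theorem card_toRight_le_card_essential [Finite V] [Finite E] (hs : IsConf bd n s)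
    (hcrit : ∀ v, ¬ L.Resp v s) (hr : mdeg bd r ≠ 2)
    (hloop : ∀ e, .inr e ∈ s → bd e true ≠ bd e false)
    (hchild : ∀ f : E, bd f true ≠ bd f false → (∀ v, v ≠ r → L.edge v ≠ f) →
      ∃ b z, z ≠ r ∧ L.parent z = bd f b) :
    s.toRight.card ≤ Nat.card {v // 3 ≤ mdeg bd v} := by
  classical
  have := Fintype.ofFinite V
  rw [Nat.card_eq_fintype_card, Fintype.card_subtype]
  refine Finset.card_le_card_of_forall_subsingleton
      (fun e w => e ∈ s.toRight ∧ Touches bd w (.inr e)) ?_ ?_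
  · intro e he
    have he' := Finset.mem_toRight.1 he
    by_cases hd : ∀ v, v ≠ r → L.edge v ≠ e
    · obtain ⟨b, z, hz, hzb⟩ := hchild e (hloop e he') hd
      exact ⟨bd e b, Finset.mem_filter.2 ⟨Finset.mem_univ _, three_le_mdeg hr hz hzb ⟨b, rfl⟩
        (hd z hz).symm fun h => (hd _ h).symm⟩, he, b, rfl⟩
    · push Not at hd
      obtain ⟨v, hv, rfl⟩ := hd
      obtain ⟨w, hw, hwr, hwv, hp⟩ := exists_of_not_resp hcrit hv he'
      refine ⟨L.parent v, Finset.mem_filter.2 ⟨Finset.mem_univ _, three_le_mdeg hr hwr hp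
        ((touches_edge hv _).2 (.inr rfl)) (fun h => hwv (edge_injOn hv hwr h).symm)
        fun hpr h => parent_ne (L := L) hv (edge_injOn hv hpr h).symm⟩, he, ?_⟩
      exact (touches_edge hv _).2 (.inr rfl)
  · rintro w - e ⟨-, he, hte⟩ f ⟨-, hf, htf⟩
    simpa using hs.eq_of_touches _ (Finset.mem_toRight.1 he) _ (Finset.mem_toRight.1 hf) _ hte htf

end LabelledTree

end Bounds

/-! ### Collapses of compact pieces -/

section Collapse

/-- A continuous map from a compact set to a Hausdorff space is closed onto its image. -/
theorem continuousOn_invFunOn_of_isCompact {Z X : Type*} [Nonempty Z] [TopologicalSpace Z]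
    [TopologicalSpace X] [T2Space X] {Q : Set Z} (hQ : IsCompact Q) {f : Z → X}
    (hf : ContinuousOn f Q) (hinj : InjOn f Q) :
    ContinuousOn (Function.invFunOn f Q) (f '' Q) := by
  rw [continuousOn_iff_isClosed]
  intro C hC
  refine ⟨f '' (Q ∩ C), ((hQ.inter_right hC).image_of_continuousOn
    (hf.mono inter_subset_left)).isClosed, ?_⟩
  ext x
  constructor
  · rintro ⟨hx, z, hz, rfl⟩
    refine ⟨⟨z, ⟨hz, ?_⟩, rfl⟩, z, hz, rfl⟩
    rwa [mem_preimage, hinj.leftInvOn_invFunOn hz] at hx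
  · rintro ⟨⟨z, ⟨hz, hzC⟩, rfl⟩, -⟩
    refine ⟨?_, z, hz, rfl⟩
    rwa [mem_preimage, hinj.leftInvOn_invFunOn hz]

open scoped unitInterval

/-- If `K` is a strong deformation retract obtained from a closed set `L` by gluing in an embedded
compact set that deforms into `L`, then `L` is a strong deformation retract as well. -/
theorem IsStrongDeformationRetract.collapse {X : Type u} [TopologicalSpace X] [T2Space X]
    {Z : Type*} [Nonempty Z] [TopologicalSpace Z] {K L : Set X}
    (hK : IsStrongDeformationRetract K) (hL : IsClosed L) {Q : Set Z} (hQ : IsCompact Q)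
    {f : Z → X} (hf : ContinuousOn f Q) (hinj : InjOn f Q) (hKL : K = L ∪ f '' Q)
    {h : I → Z → Z} (hc : ContinuousOn (Function.uncurry h) (univ ×ˢ Q)) (hmaps : ∀ u, ∀ z ∈ Q, h u z ∈ Q)
    (h0 : ∀ z ∈ Q, h 0 z = z) (hfix : ∀ u, ∀ z ∈ Q, f z ∈ L → h u z = z)
    (h1 : ∀ z ∈ Q, f (h 1 z) ∈ L) : IsStrongDeformationRetract L := by
  classical
  obtain ⟨r, hr, ⟨H⟩⟩ := hK
  -- The deformation of `K` into `L`: constant on `L`, transported by `f` on the glued piece. It is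
  -- continuous because both pieces are closed and the definitions agree on the overlap by `hfix`.
  let G : I × X → X := fun p => if p.2 ∈ L then p.2 else f (h p.1 (Function.invFunOn f Q p.2))
  have hinv : ∀ z ∈ Q, Function.invFunOn f Q (f z) = z := hinj.leftInvOn_invFunOn
  have hG1 : ∀ u, ∀ x ∈ L, G (u, x) = x := fun u x hx => if_pos hx
  have hG2 : ∀ u, ∀ z ∈ Q, G (u, f z) = f (h u z) := by
    intro u z hz
    by_cases hx : f z ∈ L
    · rw [hG1 u _ hx, hfix u z hz hx]
    · exact (if_neg hx).trans (by rw [hinv z hz])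
  have hGc : ContinuousOn G (univ ×ˢ K) := by
    have hfc : IsClosed (f '' Q) := (hQ.image_of_continuousOn hf).isClosed
    rw [hKL, prod_union]
    refine ContinuousOn.union_of_isClosed ?_ ?_ (isClosed_univ.prod hL) (isClosed_univ.prod hfc)
    · exact continuousOn_snd.congr fun p hp => hG1 p.1 p.2 hp.2
    · have : ContinuousOn (fun p : I × X => f (h p.1 (Function.invFunOn f Q p.2)))
          (univ ×ˢ (f '' Q)) := by
        refine hf.comp (hc.comp (continuousOn_fst.prodMk
          ((continuousOn_invFunOn_of_isCompact hQ hf hinj).comp continuousOn_snd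
            fun p hp => hp.2)) ?_) ?_
        · rintro ⟨u, x⟩ ⟨-, z, hz, rfl⟩
          exact ⟨mem_univ u, by simpa only [Function.comp_apply, hinv z hz] using hz⟩
        · rintro ⟨u, x⟩ ⟨-, z, hz, rfl⟩
          simpa only [hinv z hz] using hmaps u z hz
      refine this.congr ?_
      rintro ⟨u, x⟩ ⟨-, z, hz, rfl⟩
      simp only [hG2 u z hz, hinv z hz]
  have hcont : Continuous fun p : I × X => G (p.1, r p.2) :=
    hGc.comp_continuous (continuous_fst.prodMk (r.continuous.comp continuous_snd))
      fun p => ⟨mem_univ _, hr p.2⟩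
  have hLK : L ⊆ K := hKL ▸ subset_union_left
  have hrL : ∀ x ∈ L, r x = x := fun x hx => by
    have h1 := H.eq_fst 1 (hLK hx)
    simpa using h1
  refine ⟨⟨fun x => G (1, r x), hcont.comp (continuous_const.prodMk continuous_id)⟩, ?_, ?_⟩
  · intro x
    change G (1, r x) ∈ L
    have := hr x
    rw [hKL] at this
    rcases this with hx | ⟨z, hz, hzx⟩
    · rwa [hG1 _ _ hx]
    · rw [← hzx, hG2 1 z hz]
      exact h1 z hz
  · have H1 : (ContinuousMap.id X).HomotopicRel r L :=
      ⟨{ H.toHomotopy with prop' := fun u x hx => H.prop' u x (hLK hx) }⟩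
    refine H1.trans ⟨{ toFun := fun p => G (p.1, r p.2)
                       continuous_toFun := hcont
                       map_zero_left := fun x => ?_
                       map_one_left := fun x => rfl
                       prop' := fun u x hx => ?_ }⟩
    · have := hr x
      rw [hKL] at this
      rcases this with hx | ⟨z, hz, hzx⟩
      · exact hG1 _ _ hx
      · change G (0, r x) = r x
        rw [← hzx, hG2 0 z hz, h0 z hz]
    · change G (u, r x) = r x
      rw [hrL x hx, hG1 u x hx]

end Collapse

/-! ### The retraction of a cube onto all but one of its open facets -/

section Horn

variable {E : Type*} [Fintype E]

open scoped Classical in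
/-- The reciprocal of one quarter of the dilation factor of the central projection. -/
noncomputable def hornScale (e : E) (σ : ℝ) (t : E → ℝ) : ℝ :=
  max (4 * ‖Function.update t e 0‖) (3 - σ * t e)

open scoped Classical in
/-- The central projection of the cube `[-1, 1]^E` from the point with coordinates `3σ` in the
direction `e` and `0` in the other directions. -/
noncomputable def hornProj (e : E) (σ : ℝ) (t : E → ℝ) : E → ℝ := fun f =>
  if f = e then σ * (3 - 4 / hornScale e σ t * (3 - σ * t e)) else 4 / hornScale e σ t * t f

/-- The union of all facets of the cube except for the one where the coordinate `e` is `σ`. -/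
def IsHorn (e : E) (σ : ℝ) (t : E → ℝ) : Prop := (∃ f, f ≠ e ∧ |t f| = 1) ∨ σ * t e = -1

variable {e : E} {σ : ℝ} {t : E → ℝ}

theorem norm_update_le (ht : ∀ f, |t f| ≤ 1) [DecidableEq E] : ‖Function.update t e 0‖ ≤ 1 := by
  rw [pi_norm_le_iff_of_nonneg zero_le_one]
  intro f
  by_cases h : f = e
  · subst h
    simp
  · rw [Function.update_of_ne h]
    exact ht f

theorem abs_mul_sign (hσ : |σ| = 1) (a : ℝ) : |σ * a| = |a| := by
  rw [abs_mul, hσ, one_mul]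

theorem hornScale_pos (hσ : |σ| = 1) (ht : ∀ f, |t f| ≤ 1) : 0 < hornScale e σ t := by
  have h1 := (abs_le.1 ((abs_mul_sign hσ (t e)).trans_le (ht e))).2
  exact lt_max_of_lt_right (by linarith)

theorem hornScale_le (hσ : |σ| = 1) (ht : ∀ f, |t f| ≤ 1) : hornScale e σ t ≤ 4 := by
  have h1 := (abs_le.1 ((abs_mul_sign hσ (t e)).trans_le (ht e))).1
  classical
  have h2 := norm_update_le (e := e) ht
  refine max_le ?_ (by linarith)
  convert mul_le_mul_of_nonneg_left h2 (by norm_num : (0 : ℝ) ≤ 4)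
  norm_num

theorem abs_le_norm_update [DecidableEq E] {f : E} (hf : f ≠ e) :
    |t f| ≤ ‖Function.update t e 0‖ := by
  have := norm_le_pi_norm (Function.update t e 0) f
  rwa [Function.update_of_ne hf] at this

theorem hornScale_mul_le (hσ : |σ| = 1) (ht : ∀ f, |t f| ≤ 1) {f : E} (hf : f ≠ e) :
    |4 / hornScale e σ t * t f| ≤ 1 := by
  classical
  have hpos := hornScale_pos (e := e) hσ ht
  rw [abs_mul, abs_of_pos (by positivity), div_mul_eq_mul_div, div_le_one hpos]
  refine le_max_of_le_left ?_
  convert mul_le_mul_of_nonneg_left (abs_le_norm_update (t := t) hf) (by norm_num : (0 : ℝ) ≤ 4)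

/-- In the direction `e` the centre is at distance `2` from the near facet and `4` from the far one.
The dilation factor is at least `1`, so the image stays beyond the near facet, and the scale is
chosen so that it does not pass the far one. -/
theorem hornScale_coord_mem (hσ : |σ| = 1) (ht : ∀ f, |t f| ≤ 1) :
    |3 - 4 / hornScale e σ t * (3 - σ * t e)| ≤ 1 := by
  have hpos := hornScale_pos (e := e) hσ ht
  have hle := hornScale_le (e := e) hσ ht
  have h1 := (abs_le.1 ((abs_mul_sign hσ (t e)).trans_le (ht e))).2
  have h2 : 4 / hornScale e σ t * (3 - σ * t e) ≤ 4 := by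
    rw [div_mul_eq_mul_div, div_le_iff₀ hpos]
    exact mul_le_mul_of_nonneg_left (le_max_right _ _) (by norm_num)
  have h3 : 1 ≤ 4 / hornScale e σ t := by rwa [one_le_div hpos]
  rw [abs_le]
  constructor
  · linarith
  · nlinarith

theorem abs_hornProj_le (hσ : |σ| = 1) (ht : ∀ f, |t f| ≤ 1) (f : E) :
    |hornProj e σ t f| ≤ 1 := by
  unfold hornProj
  split_ifs with h
  · rw [abs_mul_sign hσ]
    exact hornScale_coord_mem hσ ht
  · exact hornScale_mul_le hσ ht h

theorem hornProj_of_eq_zero {f : E} (hf : f ≠ e) (h : t f = 0) : hornProj e σ t f = 0 := by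
  rw [hornProj, if_neg hf, h, mul_zero]

theorem sign_mul_sign (hσ : |σ| = 1) (a : ℝ) : σ * (σ * a) = a := by
  rw [← mul_assoc, ← abs_mul_abs_self σ, hσ, one_mul, one_mul]

/-- On each of the remaining facets one of the two terms of the maximum equals `4`, so the dilation
factor is `1`. -/
theorem hornProj_eq_self (hσ : |σ| = 1) (ht : ∀ f, |t f| ≤ 1) (h : IsHorn e σ t) :
    hornProj e σ t = t := by
  classical
  have h4 : hornScale e σ t = 4 := by
    refine le_antisymm (hornScale_le hσ ht) ?_
    rcases h with ⟨f, hf, h⟩ | h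
    · refine le_max_of_le_left ?_
      have := abs_le_norm_update (t := t) hf
      rw [h] at this
      convert mul_le_mul_of_nonneg_left this (by norm_num : (0 : ℝ) ≤ 4)
      norm_num
    · exact le_max_of_le_right (by linarith)
  ext f
  rw [hornProj, h4]
  split_ifs with hf
  · rw [hf]
    have := sign_mul_sign hσ (t e)
    linarith
  · ring

/-- The maximum defining the scale is attained: by the first term if the image lies on a side facet,
by the second if it lies on the facet opposite to the missing one. -/
theorem isHorn_hornProj (hσ : |σ| = 1) (ht : ∀ f, |t f| ≤ 1) : IsHorn e σ (hornProj e σ t) := by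
  classical
  by_contra hno
  unfold IsHorn at hno
  push Not at hno
  obtain ⟨h1, h2⟩ := hno
  have hpos := hornScale_pos (e := e) hσ ht
  have h3 : 3 - σ * t e < hornScale e σ t := by
    refine lt_of_le_of_ne (le_max_right _ _) fun h => h2 ?_
    rw [hornProj, if_pos rfl, sign_mul_sign hσ, h, div_mul_cancel₀ _ hpos.ne']
    norm_num
  have h4 : ‖(4 / hornScale e σ t) • Function.update t e 0‖ < 1 := by
    rw [pi_norm_lt_iff one_pos]
    intro f
    rw [Pi.smul_apply, smul_eq_mul, Real.norm_eq_abs]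
    by_cases hf : f = e
    · subst hf
      simp
    · rw [Function.update_of_ne hf]
      refine lt_of_le_of_ne (hornScale_mul_le hσ ht hf) ?_
      have := h1 f hf
      rwa [hornProj, if_neg hf] at this
  rw [norm_smul, Real.norm_of_nonneg (by positivity), div_mul_eq_mul_div, div_lt_one hpos] at h4
  refine absurd (max_lt h4 h3) ?_
  have : hornScale e σ t = max (4 * ‖Function.update t e 0‖) (3 - σ * t e) := by
    unfold hornScale
    congr!
  rw [← this]
  exact lt_irrefl _

theorem continuousOn_hornProj (hσ : |σ| = 1) :
    ContinuousOn (hornProj e σ) {t | ∀ f, |t f| ≤ 1} := by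
  classical
  have hs : Continuous (hornScale e σ) := by
    unfold hornScale
    exact (continuous_const.mul (continuous_id.update e continuous_const).norm).max
      (continuous_const.sub (continuous_const.mul (continuous_apply e)))
  have hd : ContinuousOn (fun t => 4 / hornScale e σ t) {t | ∀ f, |t f| ≤ 1} :=
    continuousOn_const.div hs.continuousOn fun t ht => (hornScale_pos hσ ht).ne'
  rw [continuousOn_pi]
  intro f
  unfold hornProj
  by_cases hf : f = e
  · simp only [if_pos hf]
    exact continuousOn_const.mul (continuousOn_const.sub (hd.mul
      (continuous_const.sub (continuous_const.mul (continuous_apply e))).continuousOn))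
  · simp only [if_neg hf]
    exact hd.mul (continuous_apply f).continuousOn

end Horn

noncomputable section

/-! ### Points of a finite graph -/

section GraphPoints

open Metric

variable {Γ : Type u} [TopologicalSpace Γ] [CWComplex (univ : Set Γ)]

theorem fin_one_mem_closedBall {a : ℝ} : (fun _ => a : Fin 1 → ℝ) ∈ closedBall 0 1 ↔ |a| ≤ 1 := by
  rw [mem_closedBall_zero_iff, pi_norm_le_iff_of_nonneg zero_le_one]
  simp

theorem fin_one_mem_ball {a : ℝ} : (fun _ => a : Fin 1 → ℝ) ∈ ball 0 1 ↔ |a| < 1 := by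
  rw [mem_ball_zero_iff, pi_norm_lt_iff one_pos]
  simp

theorem exists_vertexPoint_eq_edgeEnd (e : Edge Γ) (b : Bool) :
    ∃ v : Vertex Γ, vertexPoint v = edgeEnd e b := by
  obtain ⟨x, y, h⟩ := CWComplex.exists_cellFrontier_one_eq e
  have hm : edgeEnd e b ∈ RelCWComplex.cellFrontier 1 e := by
    rw [RelCWComplex.cellFrontier_one_eq]
    refine ⟨_, ?_, rfl⟩
    cases b
    · exact .inl rfl
    · exact .inr rfl
  rw [h, RelCWComplex.closedCell_zero_eq_singleton, RelCWComplex.closedCell_zero_eq_singleton] at hm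
  rcases hm with h | h
  · exact ⟨x, h.symm⟩
  · exact ⟨y, h.symm⟩

/-- The end of an edge as a vertex. -/
def endVertex (e : Edge Γ) (b : Bool) : Vertex Γ := (exists_vertexPoint_eq_edgeEnd e b).choose

theorem vertexPoint_endVertex (e : Edge Γ) (b : Bool) :
    vertexPoint (endVertex e b) = edgeEnd e b := (exists_vertexPoint_eq_edgeEnd e b).choose_spec

theorem vertexPoint_injective : Function.Injective (vertexPoint : Vertex Γ → Γ) :=
  RelCWComplex.injective_map_zero (univ : Set Γ)

theorem mdeg_endVertex (v : Vertex Γ) : mdeg endVertex v = degree v := by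
  refine Nat.card_congr (Equiv.subtypeEquivRight fun p => ?_)
  rw [← vertexPoint_endVertex, vertexPoint_injective.eq_iff]

/-- The closest point of `[-1, 1]`. -/
def clip (a : ℝ) : ℝ := max (-1) (min 1 a)

theorem abs_clip_le (a : ℝ) : |clip a| ≤ 1 :=
  abs_le.2 ⟨le_max_left _ _, max_le (by norm_num) (min_le_left _ _)⟩

theorem clip_of_abs_le {a : ℝ} (h : |a| ≤ 1) : clip a = a := by
  rw [clip, min_eq_right (abs_le.1 h).2, max_eq_right (abs_le.1 h).1]

theorem clip_of_le {a : ℝ} (h : a ≤ -1) : clip a = -1 := by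
  rw [clip, min_eq_right (by linarith), max_eq_left h]

theorem clip_of_ge {a : ℝ} (h : 1 ≤ a) : clip a = 1 := by
  rw [clip, min_eq_left h, max_eq_right (by norm_num)]

theorem continuous_clip : Continuous clip :=
  continuous_const.max (continuous_const.min continuous_id)

/-- The point of a closed cell of a graph with given coordinates on the edges. -/
def graphPt (t : Edge Γ → ℝ) : Vertex Γ ⊕ Edge Γ → Γ
  | .inl v => vertexPoint v
  | .inr e => RelCWComplex.map (C := (univ : Set Γ)) 1 e (fun _ => clip (t e))

/-- The cells of dimension at most `1`. -/
def toCell : Vertex Γ ⊕ Edge Γ → Σ d : ℕ, RelCWComplex.cell (univ : Set Γ) d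
  | .inl v => ⟨0, v⟩
  | .inr e => ⟨1, e⟩

/-- The open cell of the graph with index `x`. -/
def openC (x : Vertex Γ ⊕ Edge Γ) : Set Γ := RelCWComplex.openCell (toCell x).1 (toCell x).2

/-- The closed cell of the graph with index `x`. -/
def closedC (x : Vertex Γ ⊕ Edge Γ) : Set Γ := RelCWComplex.closedCell (toCell x).1 (toCell x).2

/-- The face of the cell `x` whose interior contains the point with coordinates `t`. -/
def face (t : Edge Γ → ℝ) : Vertex Γ ⊕ Edge Γ → Vertex Γ ⊕ Edge Γ
  | .inl v => .inl v
  | .inr e => if t e ≤ -1 then .inl (endVertex e false)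
      else if 1 ≤ t e then .inl (endVertex e true) else .inr e

variable {t t' : Edge Γ → ℝ} {x y : Vertex Γ ⊕ Edge Γ} {e : Edge Γ} {p : Γ}

theorem face_of_le (h : t e ≤ -1) : face t (.inr e) = .inl (endVertex e false) := if_pos h

theorem face_of_ge (h : 1 ≤ t e) : face t (.inr e) = .inl (endVertex e true) := by
  rw [face, if_neg (by linarith), if_pos h]

theorem face_of_abs_lt (h : |t e| < 1) : face t (.inr e) = .inr e := by
  rw [abs_lt] at h
  rw [face, if_neg (by linarith), if_neg (by linarith)]

theorem face_eq_or (t : Edge Γ → ℝ) (x : Vertex Γ ⊕ Edge Γ) :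
    face t x = x ∨ ∃ e b, x = .inr e ∧ face t x = .inl (endVertex e b) := by
  rcases x with v | e
  · exact .inl rfl
  · by_cases h1 : t e ≤ -1
    · exact .inr ⟨e, false, rfl, face_of_le h1⟩
    by_cases h2 : 1 ≤ t e
    · exact .inr ⟨e, true, rfl, face_of_ge h2⟩
    · exact .inl (by rw [face, if_neg h1, if_neg h2])

theorem face_eq_inr (h : face t x = .inr e) : x = .inr e ∧ |t e| < 1 := by
  have hx : x = .inr e := by
    rcases face_eq_or t x with h' | ⟨e', b, -, h'⟩
    · rw [← h', h]
    · simp [h'] at h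
  refine ⟨hx, ?_⟩
  subst hx
  by_contra hlt
  rw [abs_lt, not_and_or, not_lt, not_lt] at hlt
  rcases hlt with h' | h'
  · simp [face_of_le h'] at h
  · simp [face_of_ge h'] at h

theorem touches_of_touches_face {w : Vertex Γ} (h : Touches endVertex w (face t x)) :
    Touches endVertex w x := by
  rcases face_eq_or t x with h' | ⟨e, b, rfl, h'⟩
  · rwa [h'] at h
  · rw [h'] at h
    exact ⟨b, h⟩

theorem exists_touches (x : Vertex Γ ⊕ Edge Γ) : ∃ w, Touches endVertex w x := by
  rcases x with v | e
  · exact ⟨v, rfl⟩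
  · exact ⟨_, true, rfl⟩

theorem graphPt_face (t : Edge Γ → ℝ) (x : Vertex Γ ⊕ Edge Γ) :
    graphPt t (face t x) = graphPt t x := by
  rcases x with v | e
  · rfl
  by_cases h1 : t e ≤ -1
  · rw [face_of_le h1]
    simp [graphPt, vertexPoint_endVertex, edgeEnd, clip_of_le h1]
  by_cases h2 : 1 ≤ t e
  · rw [face_of_ge h2]
    simp [graphPt, vertexPoint_endVertex, edgeEnd, clip_of_ge h2]
  · rw [face_of_abs_lt (abs_lt.2 ⟨not_le.1 h1, not_le.1 h2⟩)]

theorem vertexPoint_mem_openC (v : Vertex Γ) : vertexPoint v ∈ openC (.inl v) := by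
  rw [openC]
  exact (RelCWComplex.openCell_zero_eq_singleton (C := (univ : Set Γ))).ge rfl

theorem graphPt_mem_openC (t : Edge Γ → ℝ) (x : Vertex Γ ⊕ Edge Γ) :
    graphPt t x ∈ openC (face t x) := by
  rw [← graphPt_face]
  rcases h : face t x with v | e
  · exact vertexPoint_mem_openC v
  · obtain ⟨-, h'⟩ := face_eq_inr h
    refine ⟨_, fin_one_mem_ball.2 ?_, rfl⟩
    rwa [clip_of_abs_le h'.le]

theorem exists_graphPt_of_mem_closedC (h : p ∈ closedC x) : ∃ t, graphPt t x = p := by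
  rcases x with v | e
  · rw [closedC] at h
    exact ⟨0, ((RelCWComplex.closedCell_zero_eq_singleton (C := (univ : Set Γ))).le h).symm⟩
  · obtain ⟨a, ha, rfl⟩ := h
    change Fin 1 → ℝ at a
    obtain ⟨c, rfl⟩ : ∃ c : ℝ, a = fun _ => c :=
      ⟨a 0, funext fun i => by rw [Subsingleton.elim i 0]⟩
    refine ⟨fun _ => c, ?_⟩
    replace ha := fin_one_mem_closedBall.1 ha
    simp only [graphPt, clip_of_abs_le ha]
    rfl

theorem exists_graphPt_of_mem_openC (h : p ∈ openC x) : ∃ t, graphPt t x = p ∧ face t x = x := by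
  rcases x with v | e
  · rw [openC] at h
    exact ⟨0, ((RelCWComplex.openCell_zero_eq_singleton (C := (univ : Set Γ))).le h).symm, rfl⟩
  · obtain ⟨a, ha, rfl⟩ := h
    change Fin 1 → ℝ at a
    obtain ⟨c, rfl⟩ : ∃ c : ℝ, a = fun _ => c :=
      ⟨a 0, funext fun i => by rw [Subsingleton.elim i 0]⟩
    replace ha := fin_one_mem_ball.1 ha
    refine ⟨fun _ => c, ?_, face_of_abs_lt ha⟩
    simp only [graphPt, clip_of_abs_le ha.le]
    rfl

theorem toCell_injective : Function.Injective (toCell : Vertex Γ ⊕ Edge Γ → _) := by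
  rintro (v | e) (w | f) h <;> simp_all [toCell]

theorem eq_of_mem_openC (hx : p ∈ openC x) (hy : p ∈ openC y) : x = y := by
  refine toCell_injective ?_
  by_contra hne
  exact (RelCWComplex.disjoint_openCell_of_ne hne).le_bot ⟨hx, hy⟩

/-- Open cells are disjoint, so the open cell containing a point does not depend on its coordinates.
-/
theorem face_eq_of_graphPt_eq (h : graphPt t x = graphPt t' y) : face t x = face t' y :=
  eq_of_mem_openC (graphPt_mem_openC t x) (h ▸ graphPt_mem_openC t' y)

/-- The open cell containing `p` is a face of both `x` and `y`, and any vertex of it will do. This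
makes disjointness of closed cells combinatorial. -/
theorem exists_touches_of_mem_closedC (hx : p ∈ closedC x) (hy : p ∈ closedC y) :
    ∃ w, Touches endVertex w x ∧ Touches endVertex w y := by
  obtain ⟨t, rfl⟩ := exists_graphPt_of_mem_closedC hx
  obtain ⟨t', h⟩ := exists_graphPt_of_mem_closedC hy
  obtain ⟨w, hw⟩ := exists_touches (face t x)
  exact ⟨w, touches_of_touches_face hw,
    touches_of_touches_face (face_eq_of_graphPt_eq h.symm ▸ hw)⟩

theorem vertexPoint_mem_closedC {w : Vertex Γ} (h : Touches endVertex w x) :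
    vertexPoint w ∈ closedC x := by
  rcases x with v | e
  · obtain rfl : v = w := h
    exact RelCWComplex.openCell_subset_closedCell _ _ (vertexPoint_mem_openC v)
  · obtain ⟨b, rfl⟩ := h
    rw [vertexPoint_endVertex]
    refine ⟨_, fin_one_mem_closedBall.2 ?_, rfl⟩
    cases b <;> simp

/-- The characteristic map of an edge is injective on the open interval; without a loop the two ends
are separated as well. -/
theorem eq_of_graphPt_inr_eq (hloop : endVertex e true ≠ endVertex e false) (ht : |t e| ≤ 1)
    (ht' : |t' e| ≤ 1) (h : graphPt t (.inr e) = graphPt t' (.inr e)) : t e = t' e := by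
  have hf := face_eq_of_graphPt_eq h
  have key : ∀ s : Edge Γ → ℝ, |s e| ≤ 1 → s e = -1 ∨ s e = 1 ∨ |s e| < 1 := by
    intro s hs
    rcases hs.lt_or_eq with h | h
    · exact .inr (.inr h)
    · rcases eq_or_eq_neg_of_abs_eq h with h | h
      · exact .inr (.inl h)
      · exact .inl h
  rcases key t ht with h1 | h1 | h1 <;> rcases key t' ht' with h2 | h2 | h2
  · rw [h1, h2]
  · rw [face_of_le h1.le, face_of_ge h2.ge] at hf
    exact absurd (by simpa using hf.symm) hloop
  · rw [face_of_le h1.le, face_of_abs_lt h2] at hf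
    simp at hf
  · rw [face_of_ge h1.ge, face_of_le h2.le] at hf
    exact absurd (by simpa using hf) hloop
  · rw [h1, h2]
  · rw [face_of_ge h1.ge, face_of_abs_lt h2] at hf
    simp at hf
  · rw [face_of_abs_lt h1, face_of_le h2.le] at hf
    simp at hf
  · rw [face_of_abs_lt h1, face_of_ge h2.ge] at hf
    simp at hf
  · simp only [graphPt, clip_of_abs_le ht, clip_of_abs_le ht'] at h
    have hinj := (RelCWComplex.map (C := (univ : Set Γ)) 1 e).injOn
    rw [RelCWComplex.source_eq] at hinj
    exact congrFun (hinj (fin_one_mem_ball.2 h1) (fin_one_mem_ball.2 h2) h) 0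

theorem continuous_graphPt (x : Vertex Γ ⊕ Edge Γ) : Continuous fun t => graphPt t x := by
  rcases x with v | e
  · exact continuous_const
  · exact (RelCWComplex.continuousOn (C := (univ : Set Γ)) 1 e).comp_continuous
      (continuous_pi fun _ => continuous_clip.comp (continuous_apply e))
      fun t => fin_one_mem_closedBall.2 (abs_clip_le _)

theorem exists_toCell (hdim : ∀ d : ℕ, 2 ≤ d → IsEmpty (RelCWComplex.cell (univ : Set Γ) d))
    (c : Σ d : ℕ, RelCWComplex.cell (univ : Set Γ) d) : ∃ x, toCell x = c := by
  obtain ⟨d, c⟩ := c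
  match d, c with
  | 0, c => exact ⟨.inl c, rfl⟩
  | 1, c => exact ⟨.inr c, rfl⟩
  | d + 2, c => exact (hdim (d + 2) (by omega)).elim c

theorem exists_mem_openC (hdim : ∀ d : ℕ, 2 ≤ d → IsEmpty (RelCWComplex.cell (univ : Set Γ) d))
    (p : Γ) : ∃ x, p ∈ openC x := by
  have h := (CWComplex.iUnion_openCell_eq_complex (C := (univ : Set Γ))).ge (mem_univ p)
  simp only [mem_iUnion] at h
  obtain ⟨d, c, h⟩ := h
  obtain ⟨x, hx⟩ := exists_toCell hdim ⟨d, c⟩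
  refine ⟨x, ?_⟩
  rw [openC, hx]
  exact h

/-- A connected graph is combinatorially connected. -/
theorem eq_univ_of_closed_under_edges [T2Space Γ] [ConnectedSpace Γ]
    [RelCWComplex.Finite (univ : Set Γ)]
    (hdim : ∀ d : ℕ, 2 ≤ d → IsEmpty (RelCWComplex.cell (univ : Set Γ) d))
    {S : Set (Vertex Γ)} {r : Vertex Γ} (hr : r ∈ S)
    (hS : ∀ e b, endVertex e b ∈ S → endVertex e (!b) ∈ S) : S = univ := by
  have : Finite (Vertex Γ) := RelCWComplex.FiniteType.finite_cell (C := (univ : Set Γ)) 0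
  have : Finite (Edge Γ) := RelCWComplex.FiniteType.finite_cell (C := (univ : Set Γ)) 1
  let A : Set Γ := ⋃ x ∈ {x | ∃ w ∈ S, Touches endVertex w x}, closedC x
  let B : Set Γ := ⋃ x ∈ {x | ∃ w ∉ S, Touches endVertex w x}, closedC x
  have hA : IsClosed A := (Set.toFinite _).isClosed_biUnion fun x _ =>
    RelCWComplex.isClosed_closedCell
  have hB : IsClosed B := (Set.toFinite _).isClosed_biUnion fun x _ =>
    RelCWComplex.isClosed_closedCell
  have hcov : univ ⊆ A ∪ B := by
    intro p _
    obtain ⟨x, hx⟩ := exists_mem_openC hdim p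
    have hx' : p ∈ closedC x := RelCWComplex.openCell_subset_closedCell _ _ hx
    obtain ⟨w, hw⟩ := exists_touches x
    by_cases hwS : w ∈ S
    · exact .inl (mem_biUnion ⟨w, hwS, hw⟩ hx')
    · exact .inr (mem_biUnion ⟨w, hwS, hw⟩ hx')
  have hmix : ∀ x w w', Touches endVertex w x → Touches endVertex w' x → w ∈ S → w' ∈ S := by
    rintro (v | e) w w' hw hw' h
    · obtain rfl : v = w := hw
      obtain rfl : v = w' := hw'
      exact h
    · obtain ⟨b, rfl⟩ := hw
      obtain ⟨b', rfl⟩ := hw'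
      by_cases hb : b' = b
      · rwa [hb]
      · rw [Bool.eq_not_of_ne hb]
        exact hS e b h
  -- A common point would give cells meeting in a vertex, and membership in `S` spreads through each
  -- cell.
  have hdisj : ¬ (univ ∩ (A ∩ B)).Nonempty := by
    rintro ⟨p, -, hpA, hpB⟩
    simp only [A, B, mem_iUnion, exists_prop] at hpA hpB
    obtain ⟨x, ⟨w, hw, hwx⟩, hx⟩ := hpA
    obtain ⟨y, ⟨w', hw', hwy⟩, hy⟩ := hpB
    obtain ⟨u, hux, huy⟩ := exists_touches_of_mem_closedC hx hy
    exact hw' (hmix y u w' huy hwy (hmix x w u hwx hux hw))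
  by_contra hne
  obtain ⟨v, hv⟩ := (ne_univ_iff_exists_notMem S).1 hne
  refine hdisj (isPreconnected_closed_iff.1 isPreconnected_univ A B hA hB hcov
    ⟨vertexPoint r, mem_univ _, ?_⟩ ⟨vertexPoint v, mem_univ _, ?_⟩)
  · exact mem_biUnion (show Sum.inl r ∈ {x | ∃ w ∈ S, Touches endVertex w x} from ⟨r, hr, rfl⟩)
      (vertexPoint_mem_closedC (x := .inl r) rfl)
  · exact mem_biUnion (show Sum.inl v ∈ {x | ∃ w ∉ S, Touches endVertex w x} from ⟨v, hv, rfl⟩)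
      (vertexPoint_mem_closedC (x := .inl v) rfl)

/-- A sufficiently subdivided graph for at least one point has no loops. -/
theorem SufficientlySubdivided.endVertex_ne {n : ℕ} (h : SufficientlySubdivided Γ n) (hn : n ≠ 0)
    (e : Edge Γ) : endVertex e true ≠ endVertex e false := by
  intro heq
  have hp : IsEdgePath (endVertex e true) (endVertex e true) [(e, true)] := by
    refine .cons ?_ ?_ (.nil _)
    · rw [heq, vertexPoint_endVertex]
      rfl
    · rw [vertexPoint_endVertex]
  have := h.le_length_loop _ _ hp fun ht => by
    have h1 : FreeGroup.of e = 1 := ht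
    exact FreeGroup.of_ne_one e h1
  simp at this
  omega

/-- The coordinates of a point of the closed cell of `DⁿΓ` obtained by ordering `s`. -/
def confPt (s : Finset (Vertex Γ ⊕ Edge Γ)) {n : ℕ} (hs : s.card = n) (t : Edge Γ → ℝ) (i : Fin n) : Γ :=
  graphPt t ((s.equivFinOfCardEq hs).symm i).1

theorem range_confPt (s : Finset (Vertex Γ ⊕ Edge Γ)) {n : ℕ} (hs : s.card = n) (t : Edge Γ → ℝ) :
    range (confPt s hs t) = graphPt t '' s := by
  ext p
  constructor
  · rintro ⟨i, rfl⟩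
    exact ⟨_, Subtype.prop _, rfl⟩
  · rintro ⟨x, hx, rfl⟩
    exact ⟨s.equivFinOfCardEq hs ⟨x, hx⟩, by simp [confPt]⟩

open scoped Classical in
theorem isFace_image_face (s : Finset (Vertex Γ ⊕ Edge Γ)) (t : Edge Γ → ℝ) :
    IsFace endVertex (s.image (face t)) s :=
  ⟨face t, fun x _ => face_eq_or t x, rfl⟩

end GraphPoints

/-! ### The cells of the unlabelled discretized configuration space -/

section ConfPoints

variable {n : ℕ} {Γ : Type u} [TopologicalSpace Γ] [T2Space Γ] [CWComplex (univ : Set Γ)]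

theorem mem_closure_openProductCell {c : Fin n → Σ d : ℕ, RelCWComplex.cell (univ : Set Γ) d}
    {x : Fin n → Γ} : x ∈ closure (openProductCell n Γ c) ↔
      ∀ i, x i ∈ RelCWComplex.closedCell (C := (univ : Set Γ)) (c i).1 (c i).2 := by
  have : openProductCell n Γ c = Set.pi univ fun i =>
      RelCWComplex.openCell (C := (univ : Set Γ)) (c i).1 (c i).2 := by
    ext
    simp [openProductCell]
  rw [this, closure_pi_set]
  simp [RelCWComplex.closure_openCell_eq_closedCell]

/-- A configuration lies in the discretized configuration space iff the closures of the cells that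
contain its points are pairwise disjoint. -/
theorem notMem_fatDiagonal_iff {x : Fin n → Γ} {c : Fin n → Vertex Γ ⊕ Edge Γ}
    (hc : ∀ i, x i ∈ openC (c i)) : x ∉ fatDiagonal n Γ ↔
      ∀ i j w, Touches endVertex w (c i) → Touches endVertex w (c j) → i = j := by
  have hx : x ∈ openProductCell n Γ (fun i => toCell (c i)) := hc
  constructor
  · intro h i j w hi hj
    by_contra hne
    -- Sliding both points to the common vertex reaches the diagonal within the closed product cell.
    refine h (mem_iUnion₂.2 ⟨_, ⟨fun l => if l = i ∨ l = j then vertexPoint w else x l, ?_, ?_⟩, hx⟩)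
    · rw [mem_closure_openProductCell]
      intro l
      change _ ∈ closedC (c l)
      split_ifs with hl
      · rcases hl with rfl | rfl
        · exact vertexPoint_mem_closedC hi
        · exact vertexPoint_mem_closedC hj
      · exact RelCWComplex.openCell_subset_closedCell _ _ (hc l)
    · exact ⟨i, j, hne, by simp⟩
  · intro h hfat
    obtain ⟨c', ⟨y, hy, i, j, hne, hij⟩, hx'⟩ := mem_iUnion₂.1 hfat
    have hcc : ∀ l, c' l = toCell (c l) := by
      intro l
      by_contra hne
      exact (RelCWComplex.disjoint_openCell_of_ne hne).le_bot ⟨hx' l, hc l⟩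
    rw [mem_closure_openProductCell] at hy
    have hyi : y i ∈ closedC (c i) := by
      have := hy i
      rwa [hcc i] at this
    have hyj : y i ∈ closedC (c j) := by
      have := hy j
      rw [hcc j] at this
      rwa [hij]
    obtain ⟨w, hw, hw'⟩ := exists_touches_of_mem_closedC hyi hyj
    exact hne (h i j w hw hw')

theorem confPt_notMem {s : Finset (Vertex Γ ⊕ Edge Γ)} (hs : IsConf endVertex n s)
    (t : Edge Γ → ℝ) : confPt s hs.card_eq t ∉ fatDiagonal n Γ := by
  refine (notMem_fatDiagonal_iff (x := confPt s hs.card_eq t) fun i => graphPt_mem_openC t _).2 ?_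
  intro i j w hi hj
  refine (s.equivFinOfCardEq hs.card_eq).symm.injective (Subtype.ext ?_)
  exact hs.eq_of_touches _ (Subtype.prop _) _ (Subtype.prop _) w (touches_of_touches_face hi)
    (touches_of_touches_face hj)

/-- The characteristic map of the cell `s` of `UDⁿΓ`, as a function of coordinates on all edges. -/
def udPt (s : Finset (Vertex Γ ⊕ Edge Γ)) (hs : IsConf endVertex n s) (t : Edge Γ → ℝ) :
    UDConf n Γ := ⟦⟨confPt s hs.card_eq t, confPt_notMem hs t⟩⟧

theorem continuous_udPt {s : Finset (Vertex Γ ⊕ Edge Γ)} (hs : IsConf endVertex n s) :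
    Continuous (udPt s hs) :=
  continuous_quotient_mk'.comp ((continuous_pi fun _ => continuous_graphPt _).subtype_mk _)

section

variable (hdim : ∀ d : ℕ, 2 ≤ d → IsEmpty (RelCWComplex.cell (univ : Set Γ) d))

include hdim

theorem DConf.injective (x : DConf n Γ) : Function.Injective x.1 := by
  choose c hc using fun i => exists_mem_openC hdim (x.1 i)
  intro i j hij
  obtain ⟨w, hw⟩ := exists_touches (c i)
  have hcc : c i = c j := eq_of_mem_openC (hc i) (hij ▸ hc j)
  exact (notMem_fatDiagonal_iff hc).1 x.2 i j w hw (hcc ▸ hw)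

/-- A point of `UDⁿΓ` is determined by the underlying set of points of the graph. -/
theorem mk_eq_mk_iff {x y : DConf n Γ} :
    (⟦x⟧ : UDConf n Γ) = ⟦y⟧ ↔ range x.1 = range y.1 := by
  rw [Quotient.eq]
  constructor
  · rintro ⟨σ, h⟩
    have : y.1 = x.1 ∘ σ := funext h
    rw [this, σ.surjective.range_comp]
  · intro h
    let σ : Fin n ≃ Fin n := (Equiv.ofInjective y.1 (DConf.injective hdim y)).trans
      ((Equiv.setCongr h.symm).trans (Equiv.ofInjective x.1 (DConf.injective hdim x)).symm)
    refine ⟨σ, fun i => ?_⟩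
    exact (Equiv.apply_ofInjective_symm (DConf.injective hdim x)
      (Equiv.setCongr h.symm (Equiv.ofInjective y.1 (DConf.injective hdim y) i))).symm

variable {s s' : Finset (Vertex Γ ⊕ Edge Γ)} (hs : IsConf endVertex n s)
  (hs' : IsConf endVertex n s') {t t' : Edge Γ → ℝ}

theorem udPt_eq_udPt_iff :
    udPt s hs t = udPt s' hs' t' ↔ graphPt t '' s = graphPt t' '' s' := by
  rw [udPt, udPt, mk_eq_mk_iff hdim, range_confPt, range_confPt]

open scoped Classical in
/-- The open cell that contains a point of `UDⁿΓ` is determined by the point. -/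
theorem image_face_eq (h : udPt s hs t = udPt s' hs' t') : s.image (face t) = s'.image (face t') := by
  rw [udPt_eq_udPt_iff hdim] at h
  have key : ∀ (s s' : Finset (Vertex Γ ⊕ Edge Γ)) (t t' : Edge Γ → ℝ),
      graphPt t '' s = graphPt t' '' s' → s.image (face t) ⊆ s'.image (face t') := by
    intro s s' t t' h y hy
    obtain ⟨x, hx, rfl⟩ := Finset.mem_image.1 hy
    obtain ⟨x', hx', hxx⟩ := h.le (mem_image_of_mem _ hx)
    exact Finset.mem_image.2 ⟨x', hx', face_eq_of_graphPt_eq hxx⟩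
  exact (key _ _ _ _ h).antisymm (key _ _ _ _ h.symm)

open scoped Classical in
theorem udPt_image_face :
    udPt (s.image (face t)) ((isFace_image_face s t).isConf hs) t = udPt s hs t := by
  rw [udPt_eq_udPt_iff hdim, Finset.coe_image, image_image]
  exact image_congr fun x _ => graphPt_face t x

/-- A point in a closed cell determines its coordinates. -/
theorem coord_eq_of_udPt_eq (h : udPt s hs t = udPt s hs t') {e : Edge Γ} (he : .inr e ∈ s)
    (hloop : endVertex e true ≠ endVertex e false) (ht : |t e| ≤ 1) (ht' : |t' e| ≤ 1) :
    t e = t' e := by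
  rw [udPt_eq_udPt_iff hdim] at h
  obtain ⟨x, hx, hxe⟩ := h.le (mem_image_of_mem _ he)
  have hf := face_eq_of_graphPt_eq hxe
  obtain ⟨w, hw⟩ := exists_touches (face t (.inr e))
  obtain rfl := hs.eq_of_touches _ hx _ he w (touches_of_touches_face (hf ▸ hw))
    (touches_of_touches_face hw)
  exact eq_of_graphPt_inr_eq hloop ht ht' hxe.symm

theorem exists_udPt_eq (x : UDConf n Γ) : ∃ s hs t, udPt s hs t = x := by
  classical
  induction x using Quotient.inductionOn with
  | _ x =>
  choose c hc using fun i => exists_mem_openC hdim (x.1 i)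
  choose t ht hft using fun i => exists_graphPt_of_mem_openC (hc i)
  have hdis := (notMem_fatDiagonal_iff hc).1 x.2
  have hinj : Function.Injective c := by
    intro i j hij
    obtain ⟨w, hw⟩ := exists_touches (c i)
    exact hdis i j w hw (hij ▸ hw)
  have hs : IsConf endVertex n (Finset.univ.image c) := by
    constructor
    · rw [Finset.card_image_of_injective _ hinj, Finset.card_univ, Fintype.card_fin]
    · intro y hy z hz w hwy hwz
      obtain ⟨i, -, rfl⟩ := Finset.mem_image.1 hy
      obtain ⟨j, -, rfl⟩ := Finset.mem_image.1 hz
      rw [hdis i j w hwy hwz]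
  -- No edge carries two points, so the separate coordinates merge into one function.
  let T : Edge Γ → ℝ := fun e => if h : ∃ i, c i = .inr e then t h.choose e else 0
  refine ⟨_, hs, T, ?_⟩
  rw [udPt, mk_eq_mk_iff hdim, range_confPt, Finset.coe_image, image_image, Finset.coe_univ,
    image_univ]
  congr 1
  ext i
  rw [← ht i]
  rcases h : c i with v | e
  · rfl
  · have hex : ∃ i, c i = .inr e := ⟨i, h⟩
    have : hex.choose = i := hinj (hex.choose_spec.trans h.symm)
    simp only [graphPt, T, dif_pos hex, this]

end

/-- `UDⁿΓ` is a Hausdorff space. -/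
instance : T2Space (UDConf n Γ) := by
  have hcont : ∀ σ : Equiv.Perm (Fin n), Continuous fun x : DConf n Γ => x.1 ∘ σ := fun σ =>
    continuous_pi fun i => (continuous_apply (σ i)).comp continuous_subtype_val
  have hperm : ∀ (σ : Equiv.Perm (Fin n)) (x : DConf n Γ), x.1 ∘ σ ∉ fatDiagonal n Γ := by
    intro σ x h
    obtain ⟨c, ⟨y, hy, i, j, hne, hij⟩, hx⟩ := mem_iUnion₂.1 h
    refine x.2 (mem_iUnion₂.2 ⟨c ∘ σ.symm, ⟨y ∘ σ.symm, ?_, σ i, σ j, σ.injective.ne hne, ?_⟩, ?_⟩)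
    · rw [mem_closure_openProductCell] at hy ⊢
      exact fun l => hy (σ.symm l)
    · simpa using hij
    · intro l
      have := hx (σ.symm l)
      simpa using this
  -- For an open quotient map, Hausdorffness means that the equivalence relation is closed; here it
  -- is a finite union of graphs of permutations.
  have hopen : IsOpenQuotientMap (Quotient.mk (permSetoid n Γ)) := by
    refine ⟨Quotient.mk_surjective, continuous_quotient_mk', fun U hU => ?_⟩
    change IsOpen (Quotient.mk (permSetoid n Γ) ⁻¹' (Quotient.mk (permSetoid n Γ) '' U))
    have : Quotient.mk (permSetoid n Γ) ⁻¹' (Quotient.mk (permSetoid n Γ) '' U) =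
        ⋃ σ : Equiv.Perm (Fin n), (fun x : DConf n Γ => (⟨x.1 ∘ σ, hperm σ x⟩ : DConf n Γ)) ⁻¹' U := by
      ext x
      simp only [mem_preimage, mem_image, mem_iUnion]
      constructor
      · rintro ⟨y, hy, h⟩
        obtain ⟨σ, hσ⟩ := Quotient.exact h.symm
        refine ⟨σ, ?_⟩
        convert hy using 1
        exact Subtype.ext (funext fun i => (hσ i).symm)
      · rintro ⟨σ, h⟩
        exact ⟨_, h, (Quotient.sound (s := permSetoid n Γ) ⟨σ, fun i => rfl⟩).symm⟩
    rw [this]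
    exact isOpen_iUnion fun σ => hU.preimage ((hcont σ).subtype_mk _)
  rw [t2Space_iff_of_isOpenQuotientMap hopen]
  have : {q : DConf n Γ × DConf n Γ | Quotient.mk (permSetoid n Γ) q.1 =
      Quotient.mk (permSetoid n Γ) q.2} =
      ⋃ σ : Equiv.Perm (Fin n), {q | q.2.1 = q.1.1 ∘ σ} := by
    ext q
    rw [mem_ofPred_eq, Quotient.eq, mem_iUnion]
    exact exists_congr fun σ => ⟨fun h => funext h, fun h i => congrFun h i⟩
  rw [this]
  exact isClosed_iUnion_of_finite fun σ => isClosed_eq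
    (continuous_subtype_val.comp continuous_snd) ((hcont σ).comp continuous_fst)

end ConfPoints

/-! ### Subcomplexes of the unlabelled discretized configuration space -/

section CellCoordinates

open Metric

variable {Γ : Type u} [TopologicalSpace Γ] [CWComplex (univ : Set Γ)]

variable {s : Finset (Vertex Γ ⊕ Edge Γ)} {t t' : Edge Γ → ℝ}

/-- The cube of coordinates on the closed cell `s`. -/
def cube (s : Finset (Vertex Γ ⊕ Edge Γ)) : Set (Edge Γ → ℝ) :=
  {t | (∀ e, |t e| ≤ 1) ∧ ∀ e, .inr e ∉ s → t e = 0}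

theorem isCompact_cube (s : Finset (Vertex Γ ⊕ Edge Γ)) : IsCompact (cube s) := by
  have : cube s = univ.pi (fun _ => Icc (-1) 1) ∩ ⋂ e, ⋂ _ : .inr e ∉ s, {t | t e = 0} := by
    ext t
    simp only [cube, mem_inter_iff, mem_univ_pi, mem_Icc, mem_iInter, abs_le, mem_ofPred_eq]
  rw [this]
  refine (isCompact_univ_pi fun _ => isCompact_Icc).inter_right ?_
  exact isClosed_iInter fun e => isClosed_iInter fun _ =>
    isClosed_eq (continuous_apply e) continuous_const

theorem clip_clip (a : ℝ) : clip (clip a) = clip a := clip_of_abs_le (abs_clip_le a)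

theorem face_of_eq_sign {e : Edge Γ} {b : Bool} (h : t e = if b then 1 else -1) :
    face t (.inr e) = .inl (endVertex e b) := by
  cases b
  · exact face_of_le (by simp [h])
  · exact face_of_ge (by simp [h])

/-- Coordinates on the edges in `s`, extended by zero. -/
def extendCoord {d : ℕ} (hd : s.toRight.card = d) (x : Fin d → ℝ) : Edge Γ → ℝ :=
  open scoped Classical in
  fun e => if h : e ∈ s.toRight then x (s.toRight.equivFinOfCardEq hd ⟨e, h⟩) else 0

section

variable {d : ℕ} (hd : s.toRight.card = d) {x : Fin d → ℝ}

theorem extendCoord_symm (x : Fin d → ℝ) (i : Fin d) :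
    extendCoord hd x ((s.toRight.equivFinOfCardEq hd).symm i) = x i := by
  rw [extendCoord, dif_pos (Subtype.prop _)]
  simp

theorem continuous_extendCoord : Continuous (extendCoord hd : _ → Edge Γ → ℝ) := by
  refine continuous_pi fun e => ?_
  unfold extendCoord
  by_cases h : e ∈ s.toRight
  · simp only [dif_pos h]
    exact continuous_apply _
  · simp only [dif_neg h]
    exact continuous_const

theorem injective_extendCoord : Function.Injective (extendCoord hd : _ → Edge Γ → ℝ) := by
  intro x y h
  ext i
  rw [← extendCoord_symm hd x i, h, extendCoord_symm]

theorem extendCoord_mem_cube (hx : x ∈ closedBall 0 1) : extendCoord hd x ∈ cube s := by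
  rw [mem_closedBall_zero_iff, pi_norm_le_iff_of_nonneg zero_le_one] at hx
  refine ⟨fun e => ?_, fun e he => dif_neg (by simpa using he)⟩
  unfold extendCoord
  split_ifs
  · exact hx _
  · simp

theorem abs_extendCoord_lt (hx : x ∈ ball 0 1) (e : Edge Γ) : |extendCoord hd x e| < 1 := by
  rw [mem_ball_zero_iff, pi_norm_lt_iff one_pos] at hx
  unfold extendCoord
  split_ifs
  · exact hx _
  · simp

open scoped Classical in
theorem image_face_extendCoord (hx : x ∈ ball 0 1) : s.image (face (extendCoord hd x)) = s := by
  have : ∀ y, face (extendCoord hd x) y = y := by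
    rintro (v | e)
    · rfl
    · exact face_of_abs_lt (abs_extendCoord_lt hd hx e)
  rw [show face (extendCoord hd x) = id from funext this, Finset.image_id]

-- In the supremum norm a boundary point of the ball has a coordinate `±1`, so at least one edge
-- shrinks to an end.
open scoped Classical in
theorem card_image_face_extendCoord_lt (hx : x ∈ sphere 0 1) :
    (s.image (face (extendCoord hd x))).toRight.card < d := by
  by_contra! hle
  have heq := (isFace_image_face s (extendCoord hd x)).eq_of_card_le (hd.trans_le hle)
  refine absurd (mem_sphere_zero_iff_norm.1 hx) (ne_of_lt ?_)
  rw [pi_norm_lt_iff one_pos]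
  intro i
  have he := ((s.toRight.equivFinOfCardEq hd).symm i).2
  rw [Finset.mem_toRight] at he
  obtain ⟨y, -, hy⟩ := Finset.mem_image.1 (heq.ge he)
  have := (face_eq_inr hy).2
  rwa [extendCoord_symm] at this

end

end CellCoordinates

section Subcomplexes

open Metric

variable {n : ℕ} {Γ : Type u} [TopologicalSpace Γ] [T2Space Γ] [CWComplex (univ : Set Γ)]

variable {s : Finset (Vertex Γ ⊕ Edge Γ)} {t t' : Edge Γ → ℝ}

variable (n) in
/-- The union of the closed cells of `UDⁿΓ` with index in `K`. -/
def realization (K : Set (Finset (Vertex Γ ⊕ Edge Γ))) : Set (UDConf n Γ) :=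
  {x | ∃ s ∈ K, ∃ hs t, udPt s hs t = x}

theorem udPt_congr (hs : IsConf endVertex n s) (h : ∀ e, .inr e ∈ s → clip (t e) = clip (t' e)) :
    udPt s hs t = udPt s hs t' := by
  have : confPt s hs.card_eq t = confPt s hs.card_eq t' := by
    ext i
    have hi := ((s.equivFinOfCardEq hs.card_eq).symm i).2
    unfold confPt
    rcases hx : ((s.equivFinOfCardEq hs.card_eq).symm i).1 with v | e
    · rfl
    · rw [hx] at hi
      simp only [graphPt, h e hi]
  simp only [udPt, this]

theorem range_udPt (hs : IsConf endVertex n s) : range (udPt s hs) = udPt s hs '' cube s := by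
  classical
  refine subset_antisymm ?_ (image_subset_range _ _)
  rintro _ ⟨t, rfl⟩
  refine ⟨fun e => if .inr e ∈ s then clip (t e) else 0, ⟨fun e => ?_, fun e he => if_neg he⟩,
    udPt_congr hs fun e he => ?_⟩
  · dsimp only
    split_ifs
    · exact abs_clip_le _
    · simp
  · rw [if_pos he, clip_clip]

theorem isClosed_realization [Finite (Vertex Γ)] [Finite (Edge Γ)]
    (K : Set (Finset (Vertex Γ ⊕ Edge Γ))) : IsClosed (realization n K) := by
  have : realization n K = ⋃ s : {s : Finset (Vertex Γ ⊕ Edge Γ) // s ∈ K ∧ IsConf endVertex n s},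
      range (udPt s.1 s.2.2) := by
    ext x
    simp only [realization, mem_iUnion, mem_range, Subtype.exists]
    constructor
    · rintro ⟨s, h, hs, t, rfl⟩
      exact ⟨s, ⟨h, hs⟩, t, rfl⟩
    · rintro ⟨s, ⟨h, hs⟩, t, rfl⟩
      exact ⟨s, h, hs, t, rfl⟩
  rw [this]
  refine isClosed_iUnion_of_finite fun s => ?_
  rw [range_udPt]
  exact ((isCompact_cube _).image (continuous_udPt _)).isClosed

section

variable (hdim : ∀ d : ℕ, 2 ≤ d → IsEmpty (RelCWComplex.cell (univ : Set Γ) d))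

include hdim

theorem injOn_udPt (hs : IsConf endVertex n s)
    (hloop : ∀ e, .inr e ∈ s → endVertex e true ≠ endVertex e false) :
    InjOn (udPt s hs) (cube s) := by
  intro t ht t' ht' h
  ext e
  by_cases he : .inr e ∈ s
  · exact coord_eq_of_udPt_eq hdim hs h he (hloop e he) (ht.1 e) (ht'.1 e)
  · rw [ht.2 e he, ht'.2 e he]

-- A face-closed family contains the open cell of every point of its realization. Questions about
-- points of a subcomplex thus become questions about indices.
open scoped Classical in
theorem udPt_mem_realization_iff {K : Set (Finset (Vertex Γ ⊕ Edge Γ))}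
    (hlow : ∀ s ∈ K, ∀ t, IsFace endVertex t s → t ∈ K) (hs : IsConf endVertex n s) :
    udPt s hs t ∈ realization n K ↔ s.image (face t) ∈ K := by
  constructor
  · rintro ⟨s', h, hs', t', heq⟩
    rw [← image_face_eq hdim hs' hs heq]
    exact hlow s' h _ (isFace_image_face s' t')
  · intro h
    exact ⟨_, h, _, t, udPt_image_face hdim hs⟩

end

/-- Removing a cell together with one of its free facets is a strong deformation retraction. -/
theorem isStrongDeformationRetract_diff [Finite (Vertex Γ)] [Finite (Edge Γ)]
    (hdim : ∀ d : ℕ, 2 ≤ d → IsEmpty (RelCWComplex.cell (univ : Set Γ) d))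
    {r : Vertex Γ} {L : LabelledTree endVertex r}
    (hloop : ∀ s, IsConf (endVertex (Γ := Γ)) n s → ∀ e, .inr e ∈ s →
      endVertex e true ≠ endVertex e false)
    {K : Set (Finset (Vertex Γ ⊕ Edge Γ))} (hK : ∀ s ∈ K, IsConf endVertex n s)
    (hlow : ∀ s ∈ K, ∀ t, IsFace endVertex t s → t ∈ K)
    {a : Finset (Vertex Γ ⊕ Edge Γ)} {v : Vertex Γ} (ha : a ∈ K) (hb : L.up v a ∈ K)
    (hv : L.Unblocked v a)
    (hfree : ∀ s ∈ K, ∀ t, IsFace endVertex t s → t ∈ ({a, L.up v a} : Set _) →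
      s ∈ ({a, L.up v a} : Set _))
    (hsdr : IsStrongDeformationRetract (realization n K)) :
    IsStrongDeformationRetract (realization n (K \ {a, L.up v a})) := by
  classical
  have := Fintype.ofFinite (Edge Γ)
  have hac := hK a ha
  have hbc := hK _ hb
  have hlow' : ∀ s ∈ K \ {a, L.up v a}, ∀ t, IsFace endVertex t s → t ∈ K \ {a, L.up v a} :=
    fun s hs t hts => ⟨hlow s hs.1 t hts, fun h => hs.2 (hfree s hs.1 t hts h)⟩
  obtain ⟨β, hβ, hβ'⟩ := L.ends v hv.1
  have heb : .inr (L.edge v) ∈ L.up v a := LabelledTree.mem_up.2 (.inl rfl)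
  have hdown : a = insert (.inl v) ((L.up v a).erase (.inr (L.edge v))) := (hv.down_up hac).symm
  -- `σ` is the coordinate of `v` on its tree edge, so the free facet `a` of the cube is where that
  -- coordinate equals `σ`.
  obtain ⟨σ, hσdef⟩ : ∃ σ : ℝ, σ = if β then 1 else -1 := ⟨_, rfl⟩
  have hσ : |σ| = 1 := by cases β <;> simp [hσdef]
  have hpos : ∀ t : Edge Γ → ℝ, σ * t (L.edge v) = 1 → face t (.inr (L.edge v)) = .inl v := by
    intro t ht
    rw [face_of_eq_sign (b := β), hβ]
    have := sign_mul_sign hσ (t (L.edge v))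
    rw [ht, mul_one] at this
    rw [← this, hσdef]
  have hneg : ∀ t : Edge Γ → ℝ, σ * t (L.edge v) = -1 →
      face t (.inr (L.edge v)) = .inl (L.parent v) := by
    intro t ht
    rw [face_of_eq_sign (b := !β), hβ']
    have := sign_mul_sign hσ (t (L.edge v))
    rw [ht] at this
    rw [← this, hσdef]
    cases β <;> simp
  -- Off the horn, the open cell of the point is `a` or `L.up v a`. On the horn, it lacks an edge
  -- that both of these contain, or it contains the parent of `v`, which neither does.
  have hhorn : ∀ t ∈ cube (L.up v a), udPt _ hbc t ∈ realization n (K \ {a, L.up v a}) ↔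
      IsHorn (L.edge v) σ t := by
    intro t ht
    rw [udPt_mem_realization_iff hdim hlow' hbc]
    constructor
    · rintro ⟨-, hno⟩
      by_contra hnh
      unfold IsHorn at hnh
      push Not at hnh
      obtain ⟨h1, h2⟩ := hnh
      have herase : ((L.up v a).erase (.inr (L.edge v))).image (face t) =
          (L.up v a).erase (.inr (L.edge v)) := by
        have : ∀ x ∈ (L.up v a).erase (.inr (L.edge v)), face t x = x := by
          rintro (w | f) hx
          · rfl
          · exact face_of_abs_lt (lt_of_le_of_ne (ht.1 f)
              (h1 f (by simpa using Finset.ne_of_mem_erase hx)))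
        ext y
        rw [Finset.mem_image]
        exact ⟨fun ⟨x, hx, h⟩ => by rwa [← h, this x hx], fun hy => ⟨y, hy, this y hy⟩⟩
      refine hno ?_
      rw [← Finset.insert_erase heb, Finset.image_insert, herase]
      rcases (ht.1 (L.edge v)).lt_or_eq with h | h
      · rw [face_of_abs_lt h]
        exact .inr rfl
      · rw [← abs_mul_sign hσ] at h
        rw [hpos t ((eq_or_eq_neg_of_abs_eq h).resolve_right h2), ← hdown,
          Finset.insert_erase heb]
        exact .inl rfl
    · intro hh
      have hface := isFace_image_face (L.up v a) t
      refine ⟨hlow _ hb _ hface, ?_⟩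
      have hmem : ∀ f, .inr f ∈ (L.up v a).image (face t) → |t f| < 1 := by
        intro f hf
        obtain ⟨y, -, hy⟩ := Finset.mem_image.1 hf
        exact (face_eq_inr hy).2
      rcases hh with ⟨f, hf, h⟩ | h
      · have hfb : .inr f ∈ L.up v a := by
          by_contra hfb
          rw [ht.2 f hfb] at h
          simp at h
        rintro (h' | h')
        · refine absurd h (hmem f ?_).ne
          rw [h', hdown]
          exact Finset.mem_insert_of_mem (Finset.mem_erase.2 ⟨by simpa using hf, hfb⟩)
        · exact absurd h (hmem f (by rw [h']; exact hfb)).ne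
      · have hp : .inl (L.parent v) ∈ (L.up v a).image (face t) :=
          Finset.mem_image.2 ⟨_, heb, hneg t h⟩
        rintro (h' | h')
        · rw [h'] at hp
          exact hv.2.2 _ hp rfl
        · rw [h'] at hp
          have := hbc.eq_of_touches _ hp _ heb (L.parent v) rfl
            ((LabelledTree.touches_edge hv.1 _).2 (.inr rfl))
          simp at this
  have hKL : realization n K =
      realization n (K \ {a, L.up v a}) ∪ udPt _ hbc '' cube (L.up v a) := by
    rw [← range_udPt]
    apply subset_antisymm
    · rintro _ ⟨s, hsK, hs, t, rfl⟩
      by_cases hmem : s.image (face t) ∈ ({a, L.up v a} : Set _)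
      · right
        rw [← udPt_image_face hdim hs]
        have key : ∀ c (hc : IsConf endVertex n c), c ∈ ({a, L.up v a} : Set _) →
            udPt c hc t ∈ range (udPt _ hbc) := by
          rintro c hc (rfl | rfl)
          -- A point of `a` is a point of the larger cell with the coordinate of the tree edge set
          -- to the end `v`.
          · refine ⟨Function.update t (L.edge v) σ, ?_⟩
            rw [udPt_eq_udPt_iff hdim]
            have hsame : ∀ x, x ≠ .inr (L.edge v) →
                graphPt (Function.update t (L.edge v) σ) x = graphPt t x := by
              rintro (w | f) hx
              · rfl
              · simp only [graphPt]
                rw [Function.update_of_ne (by simpa using hx)]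
            have hv' : graphPt (Function.update t (L.edge v) σ) (.inr (L.edge v)) =
                graphPt t (.inl v) := by
              rw [← graphPt_face, hpos _ (by
                rw [Function.update_self, ← abs_mul_abs_self σ, hσ, one_mul])]
              rfl
            apply subset_antisymm
            · rintro _ ⟨x, hx, rfl⟩
              rcases LabelledTree.mem_up.1 hx with rfl | ⟨-, hx⟩
              · exact ⟨_, hv.2.1, hv'.symm⟩
              · refine ⟨x, hx, (hsame x ?_).symm⟩
                rintro rfl
                exact LabelledTree.inr_notMem_of_inl_mem hac hv.1 hv.2.1 hx
            · rintro _ ⟨x, hx, rfl⟩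
              by_cases hxv : x = .inl v
              · subst hxv
                exact ⟨_, heb, hv'⟩
              · refine ⟨x, LabelledTree.mem_up.2 (.inr ⟨hxv, hx⟩), hsame x ?_⟩
                rintro rfl
                exact LabelledTree.inr_notMem_of_inl_mem hac hv.1 hv.2.1 hx
          · exact ⟨t, rfl⟩
        exact key _ _ hmem
      · exact .inl ⟨_, ⟨hlow s hsK _ (isFace_image_face s t), hmem⟩, _, t, udPt_image_face hdim hs⟩
    · rintro x (⟨s, hs, h⟩ | ⟨t, rfl⟩)
      · exact ⟨s, hs.1, h⟩
      · exact ⟨_, hb, hbc, t, rfl⟩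
  -- Straight-line homotopy in the cube from the identity to the central projection.
  refine hsdr.collapse (isClosed_realization _) (isCompact_cube (L.up v a))
    (continuous_udPt hbc).continuousOn (injOn_udPt hdim hbc (hloop _ hbc)) hKL
    (h := fun u t f => (1 - (u : ℝ)) * t f + u * hornProj (L.edge v) σ t f) ?_ ?_ ?_ ?_ ?_
  · have hproj : ContinuousOn (fun p : unitInterval × (Edge Γ → ℝ) => hornProj (L.edge v) σ p.2)
        (univ ×ˢ cube (L.up v a)) :=
      (continuousOn_hornProj hσ).comp continuousOn_snd fun p hp => hp.2.1
    rw [continuousOn_pi] at hproj ⊢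
    intro f
    have hu : Continuous fun p : unitInterval × (Edge Γ → ℝ) => (p.1 : ℝ) :=
      continuous_subtype_val.comp continuous_fst
    exact (((continuous_const.sub hu).mul ((continuous_apply f).comp continuous_snd)).continuousOn).add
      (hu.continuousOn.mul (hproj f))
  · rintro ⟨u, hu0, hu1⟩ t ht
    refine ⟨fun f => ?_, fun f hf => ?_⟩
    · have h1 := abs_le.1 (ht.1 f)
      have h2 := abs_le.1 (abs_hornProj_le (e := L.edge v) hσ ht.1 f)
      rw [abs_le]
      dsimp only
      constructor <;> nlinarith
    · have hfe : f ≠ L.edge v := fun h => hf (h ▸ heb)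
      dsimp only
      rw [hornProj_of_eq_zero hfe (ht.2 f hf), ht.2 f hf]
      simp
  · intro t _
    ext f
    simp
  · intro u t ht h
    ext f
    rw [hornProj_eq_self hσ ht.1 ((hhorn t ht).1 h)]
    ring
  · intro t ht
    have hmem : hornProj (L.edge v) σ t ∈ cube (L.up v a) := by
      refine ⟨abs_hornProj_le hσ ht.1, fun f hf => hornProj_of_eq_zero ?_ (ht.2 f hf)⟩
      exact fun h => hf (h ▸ heb)
    have := (hhorn _ hmem).2 (isHorn_hornProj hσ ht.1)
    convert this using 2
    ext f
    simp

/-! ### The cell structure -/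

theorem image_udPt_extendCoord {d : ℕ} (hd : s.toRight.card = d) (hs : IsConf endVertex n s) :
    (fun x => udPt s hs (extendCoord hd x)) '' closedBall 0 1 = range (udPt s hs) := by
  apply subset_antisymm
  · rintro _ ⟨x, -, rfl⟩
    exact ⟨_, rfl⟩
  · rintro _ ⟨t, rfl⟩
    refine ⟨fun i => clip (t ((s.toRight.equivFinOfCardEq hd).symm i)), ?_,
      udPt_congr hs fun e he => ?_⟩
    · rw [mem_closedBall_zero_iff, pi_norm_le_iff_of_nonneg zero_le_one]
      exact fun i => abs_clip_le _
    · rw [extendCoord, dif_pos (by simpa using he)]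
      simp [clip_clip]

/-- A subcomplex of `UDⁿΓ` is a CW complex. -/
theorem exists_cwComplex_realization [Finite (Vertex Γ)] [Finite (Edge Γ)]
    (hdim : ∀ d : ℕ, 2 ≤ d → IsEmpty (RelCWComplex.cell (univ : Set Γ) d))
    (hloop : ∀ s, IsConf (endVertex (Γ := Γ)) n s → ∀ e, .inr e ∈ s →
      endVertex e true ≠ endVertex e false)
    {K : Set (Finset (Vertex Γ ⊕ Edge Γ))} (hK : ∀ s ∈ K, IsConf endVertex n s)
    (hlow : ∀ s ∈ K, ∀ t, IsFace endVertex t s → t ∈ K) :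
    ∃ _ : CWComplex (realization n K), ∀ d : ℕ, (∀ s ∈ K, s.toRight.card ≠ d) →
      IsEmpty (RelCWComplex.cell (realization n K) d) := by
  classical
  let C : ℕ → Type u := fun d => {s : Finset (Vertex Γ ⊕ Edge Γ) // s ∈ K ∧ s.toRight.card = d}
  let f : (d : ℕ) → C d → (Fin d → ℝ) → UDConf n Γ := fun d s x =>
    udPt s.1 (hK _ s.2.1) (extendCoord s.2.2 x)
  have hf : ∀ d s, Continuous (f d s) := fun d s =>
    (continuous_udPt _).comp (continuous_extendCoord _)
  have hinj : ∀ d s, InjOn (f d s) (closedBall 0 1) := fun d s x hx y hy h =>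
    injective_extendCoord s.2.2 (injOn_udPt hdim (hK _ s.2.1) (hloop _ (hK _ s.2.1))
      (extendCoord_mem_cube _ hx) (extendCoord_mem_cube _ hy) h)
  have hinj' : ∀ d s, InjOn (f d s) (ball 0 1) := fun d s => (hinj d s).mono ball_subset_closedBall
  have himage : ∀ d (s : C d), f d s '' closedBall 0 1 = range (udPt s.1 (hK _ s.2.1)) :=
    fun d s => image_udPt_extendCoord s.2.2 _
  have hfin : ∀ d, Finite (C d) := fun d => inferInstance
  refine ⟨CWComplex.mkFinite (realization n K) C
    (fun d s => (hinj' d s).toPartialEquiv (f d s) (ball 0 1)) ?_ hfin (fun _ _ => rfl)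
    (fun d s => (hf d s).continuousOn) ?_ ?_ ?_ ?_, fun d hd => ⟨fun s => hd s.1 s.2.1 s.2.2⟩⟩
  · have := Fintype.ofFinite (Edge Γ)
    filter_upwards [Filter.eventually_gt_atTop (Fintype.card (Edge Γ))] with d hd
    refine ⟨fun s => absurd (Finset.card_le_univ s.1.toRight) ?_⟩
    rw [s.2.2]
    exact not_le.2 hd
  · intro d s
    have h1 := (continuousOn_invFunOn_of_isCompact (isCompact_closedBall 0 1)
      (hf d s).continuousOn (hinj d s)).mono (image_mono ball_subset_closedBall)
    refine h1.congr ?_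
    rintro _ ⟨x, hx, rfl⟩
    change Function.invFunOn (f d s) (ball 0 1) (f d s x) = _
    rw [(hinj' d s).leftInvOn_invFunOn hx, (hinj d s).leftInvOn_invFunOn (ball_subset_closedBall hx)]
  · rintro ⟨d, s⟩ - ⟨d', s'⟩ - hne
    rw [Function.onFun, Set.disjoint_left]
    rintro _ ⟨x, hx, rfl⟩ ⟨y, hy, hxy⟩
    have := image_face_eq hdim (hK _ s'.2.1) (hK _ s.2.1) hxy
    rw [image_face_extendCoord _ hx, image_face_extendCoord _ hy] at this
    obtain ⟨s, hs, rfl⟩ := s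
    obtain ⟨s', hs', rfl⟩ := s'
    dsimp only at this
    subst this
    exact hne rfl
  · intro d s x hx
    have hface := isFace_image_face s.1 (extendCoord s.2.2 x)
    refine mem_iUnion₂.2 ⟨_, card_image_face_extendCoord_lt s.2.2 hx, mem_iUnion.2
      ⟨⟨_, hlow _ s.2.1 _ hface, rfl⟩, ?_⟩⟩
    refine (himage _ _).ge ?_
    exact ⟨extendCoord s.2.2 x, udPt_image_face hdim (hK _ s.2.1)⟩
  · ext x
    simp only [mem_iUnion]
    constructor
    · rintro ⟨d, s, y, -, rfl⟩
      exact ⟨s.1, s.2.1, hK _ s.2.1, _, rfl⟩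
    · rintro ⟨s, hs, hsc, t, rfl⟩
      exact ⟨_, ⟨s, hs, rfl⟩, (himage _ _).ge ⟨t, rfl⟩⟩

end Subcomplexes

end

/-! ### Assembly of the retraction and the dimension bound -/

section Final

variable {n : ℕ} {Γ : Type u} [TopologicalSpace Γ] [T2Space Γ] [CWComplex (univ : Set Γ)]

theorem isStrongDeformationRetract_univ {X : Type u} [TopologicalSpace X] :
    IsStrongDeformationRetract (univ : Set X) :=
  ⟨.id X, fun _ => mem_univ _, .refl _⟩

theorem realization_isConf
    (hdim : ∀ d : ℕ, 2 ≤ d → IsEmpty (RelCWComplex.cell (univ : Set Γ) d)) :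
    realization n {s | IsConf (endVertex (Γ := Γ)) n s} = univ := by
  refine eq_univ_of_forall fun x => ?_
  obtain ⟨s, hs, t, rfl⟩ := exists_udPt_eq hdim x
  exact ⟨s, hs, hs, t, rfl⟩

/-- A proper face has dimension below `k`, where the core contains every cell. -/
theorem LabelledTree.isFace_mem_core {V E : Type*} {bd : E → Bool → V} {r : V}
    {L : LabelledTree bd r} {k : ℤ} {s : Finset (V ⊕ E)} (hs : s ∈ L.core n k)
    {t : Finset (V ⊕ E)} (ht : IsFace bd t s) : t ∈ L.core n k := by
  by_cases hc : s.toRight.card ≤ t.toRight.card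
  · rwa [ht.eq_of_card_le hc]
  · obtain ⟨h1, h2, -⟩ := hs
    exact ⟨ht.isConf h1, by omega, fun _ _ => by omega⟩

end Final

/-- `UDⁿΓ` strong deformation retracts onto a subcomplex of small dimension. -/
theorem exists_strongDeformationRetract_dim_le (n : ℕ) (Γ : Type u) [TopologicalSpace Γ] [T2Space Γ] [ConnectedSpace Γ]
    [CWComplex (univ : Set Γ)] [RelCWComplex.Finite (univ : Set Γ)]
    (hdim : ∀ d : ℕ, 2 ≤ d → IsEmpty (RelCWComplex.cell (univ : Set Γ) d))
    (hcircle : ∃ v : Vertex Γ, degree v ≠ 2)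
    (hΓ : SufficientlySubdivided Γ n) :
    ∃ (Y : Set (UDConf n Γ)) (_ : CWComplex Y),
      IsStrongDeformationRetract Y ∧
      ∀ d : ℕ, min (((n : ℤ) + 1 - eulerChar Γ) / 2)
          (Nat.card {v : Vertex Γ // IsEssential v} : ℤ) < (d : ℤ) →
        IsEmpty (RelCWComplex.cell Y d) := by
  classical
  have : Finite (Vertex Γ) := RelCWComplex.FiniteType.finite_cell (C := (univ : Set Γ)) 0
  have : Finite (Edge Γ) := RelCWComplex.FiniteType.finite_cell (C := (univ : Set Γ)) 1
  have := Fintype.ofFinite (Vertex Γ)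
  have := Fintype.ofFinite (Edge Γ)
  obtain ⟨r, hr⟩ := hcircle
  rw [← mdeg_endVertex] at hr
  have hloop : ∀ s, IsConf (endVertex (Γ := Γ)) n s → ∀ e, .inr e ∈ s →
      endVertex e true ≠ endVertex e false := by
    intro s hs e he
    refine hΓ.endVertex_ne ?_ e
    rw [← hs.card_eq]
    exact Finset.card_ne_zero_of_mem he
  have hconn : ∀ S : Set (Vertex Γ), r ∈ S →
      (∀ e b, endVertex e b ∈ S → endVertex e (!b) ∈ S) → S = univ :=
    fun S h1 h2 => eq_univ_of_closed_under_edges hdim h1 h2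
  set k : ℤ := min (((n : ℤ) + 1 - eulerChar Γ) / 2)
    (Nat.card {v : Vertex Γ // IsEssential v} : ℤ) with hk
  have hchi : eulerChar Γ = (Fintype.card (Vertex Γ) : ℤ) - Fintype.card (Edge Γ) := by
    rw [eulerChar, Nat.card_eq_fintype_card, Nat.card_eq_fintype_card]
  rcases isEmpty_or_nonempty (Edge Γ) with hE | hE
  -- Without edges there is no spanning tree structure, but `Γ` is a single vertex: all cells have
  -- dimension `0`, and `k` is nonnegative.
  · obtain ⟨hY, hcell⟩ := exists_cwComplex_realization (n := n) hdim hloop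
      (K := {s | IsConf (endVertex (Γ := Γ)) n s}) (fun s hs => hs) fun s hs t ht => ht.isConf hs
    refine ⟨_, hY, (realization_isConf hdim).symm ▸ isStrongDeformationRetract_univ,
      fun d hd => hcell d fun s _ hsd => ?_⟩
    have h0 : d = 0 := by
      rw [← hsd, Finset.card_eq_zero]
      exact Finset.eq_empty_of_isEmpty _
    have hV : Fintype.card (Vertex Γ) ≤ 1 := by
      have h := hconn {r} rfl fun e => hE.elim e
      exact Fintype.card_le_one_iff.2 fun a b =>
        (h.ge (mem_univ a)).trans (h.ge (mem_univ b)).symm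
    rw [Fintype.card_eq_zero (α := Edge Γ)] at hchi
    refine absurd hd (not_lt.2 ?_)
    rw [h0, hk, hchi]
    refine le_min ?_ ?_ <;> omega
  · obtain ⟨T, hT⟩ := exists_spanTree_child hconn
    obtain ⟨L, hLp, hLe⟩ := T.exists_labelledTree
    rw [← hLp, ← hLe] at hT
    have hcrit : ∀ s, IsConf endVertex n s → (∀ v, ¬ L.Resp v s) →
        (s.toRight.card : ℤ) ≤ k := by
      intro s hs hno
      refine le_min ?_ ?_
      · have := LabelledTree.two_mul_card_toRight_le hs hno
        rw [hchi]
        omega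
      · have := LabelledTree.card_toRight_le_card_essential hs hno hr (hloop s hs) hT
        simp only [mdeg_endVertex] at this
        exact_mod_cast this
    have hsdr : IsStrongDeformationRetract (realization n (L.core n k)) := by
      refine LabelledTree.collapse_induction hloop hcrit
        (fun K => IsStrongDeformationRetract (realization n K)) ?_ ?_
      · rw [realization_isConf hdim]
        exact isStrongDeformationRetract_univ
      · intro K hK hlow a v ha hb hv hfree hP
        exact isStrongDeformationRetract_diff hdim hloop hK hlow ha hb hv hfree hP
    obtain ⟨hY, hcell⟩ := exists_cwComplex_realization (n := n) hdim hloop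
      (K := L.core n k) (fun s hs => hs.1) fun s hs t ht => LabelledTree.isFace_mem_core hs ht
    exact ⟨_, hY, hsdr, fun d hd => hcell d fun s hs hsd => absurd hs.2.1 (by rw [hsd]; omega)⟩

end GraphBraid

theorem theorem4p4 (n : ℕ) (Γ : Type u) [TopologicalSpace Γ] [T2Space Γ] [ConnectedSpace Γ]
    [CWComplex (univ : Set Γ)] [RelCWComplex.Finite (univ : Set Γ)]
    (hdim : ∀ d : ℕ, 2 ≤ d → IsEmpty (RelCWComplex.cell (univ : Set Γ) d))
    (hcircle : ∃ v : GraphBraid.Vertex Γ, GraphBraid.degree v ≠ 2)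
    (hΓ : GraphBraid.SufficientlySubdivided Γ n) :
    ∃ (Y : Set (GraphBraid.UDConf n Γ)) (_ : CWComplex Y),
      GraphBraid.IsStrongDeformationRetract Y ∧
      ∀ d : ℕ, min (((n : ℤ) + 1 - GraphBraid.eulerChar Γ) / 2)
          (Nat.card {v : GraphBraid.Vertex Γ // GraphBraid.IsEssential v} : ℤ) < (d : ℤ) →
        IsEmpty (RelCWComplex.cell Y d) := by
  exact GraphBraid.exists_strongDeformationRetract_dim_le n Γ hdim hcircle hΓ
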